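/- Let $M=(V,d)$ be a finite metric space with a designated initial state $v_0\in V$. In the metrical task system on $M$, a task is a function $t:V\to[0,\infty]$. Serving a finite task sequence $\sigma=(t_1,\dots,t_m)$ along states $u_0=v_0,u_1,\dots,u_m\in V$ costs $\sum_{i=1}^m\bigl(d(u_{i-1},u_i)+t_i(u_i)\bigr)$, and $\mathrm{cost}_{\mathrm{OPT}}(\sigma)$ is the minimum of this cost over all $u_1,\dots,u_m$. A randomized online algorithm $A$ starts in $v_0$ and chooses each state $u_i$ as a function of $t_1,\dots,t_i$ and of random bits only; its expected cost on $\sigma$ is denoted by $\mathrm{E}[\mathrm{cost}_A(\sigma)]$. For a real number $r\ge 0$, $A$ is called $r$-competitive against an oblivious adversary if there is a constant $c$ such that $\mathrm{E}[\mathrm{cost}_A(\sigma)]\le r\cdot\mathrm{cost}_{\mathrm{OPT}}(\sigma)+c$ for every finite task sequence $\sigma$. Theorem. There is a universal constant $C>0$ such that for every metric space $M$ on $n\ge 3$ points, every initial state, and every randomized online algorithm $A$ for the metrical task system on $M$: if $A$ is $r$-competitive against an oblivious adversary, then $$r\;\ge\; C\,\frac{\log n}{(\log\log n)^2}.$$ That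 is, the competitive ratio of every randomized online algorithm for the metrical task system on an $n$-point metric space is $\Omega(\log n/\log^2\log n)$. -/

import Mathlib

open MeasureTheory
open scoped ENNReal NNReal

namespace MTS

/-- A task assigns to every state a service cost in `[0, ∞]`. -/
abbrev Task (V : Type*) := V → ℝ≥0∞

/-- The cost of serving the task sequence `σ` along the trajectory `u`, where `u 0` is the starting
state and `u (i + 1)` is the state in which the `i`-th task (counted from `0`) is served: every
task costs the distance moved plus the service cost in the new state. -/
noncomputable def cost {V : Type*} [MetricSpace V] (σ : List (Task V)) (u : ℕ → V) : ℝ≥0∞ :=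
  ∑ i : Fin σ.length, (edist (u (i : ℕ)) (u ((i : ℕ) + 1)) + σ.get i (u ((i : ℕ) + 1)))

/-- The optimal offline cost of serving `σ` from the initial state `v₀`. -/
noncomputable def optCost {V : Type*} [MetricSpace V] (v₀ : V) (σ : List (Task V)) : ℝ≥0∞ :=
  ⨅ (u : ℕ → V) (_ : u 0 = v₀), cost σ u

/-- A randomized online algorithm with initial state `v₀` and random source `Ω`. After the tasks
`τ` have arrived (in this order) it is in the state `state τ ω`, which depends only on the tasks
seen so far and on the random outcome `ω`. -/
structure RandomizedAlgorithm (V : Type*) (v₀ : V) (Ω : Type*) [MeasurableSpace Ω] where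
  state : List (Task V) → Ω → V
  state_nil : ∀ ω, state [] ω = v₀
  measurableSet_state : ∀ (τ : List (Task V)) (v : V), MeasurableSet {ω | state τ ω = v}

/-- The expected cost of the algorithm on the task sequence `σ`. -/
noncomputable def RandomizedAlgorithm.expectedCost {V : Type*} [MetricSpace V] {v₀ : V}
    {Ω : Type*} [MeasurableSpace Ω] (A : RandomizedAlgorithm V v₀ Ω) (P : Measure Ω)
    (σ : List (Task V)) : ℝ≥0∞ :=
  ∫⁻ ω, cost σ (fun i => A.state (σ.take i) ω) ∂P

/-- `r`-competitiveness against an oblivious adversary: the task sequence is fixed independently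
of the random outcome, and the additive constant `c` does not depend on it. -/
def RandomizedAlgorithm.IsCompetitive {V : Type*} [MetricSpace V] {v₀ : V}
    {Ω : Type*} [MeasurableSpace Ω] (A : RandomizedAlgorithm V v₀ Ω) (P : Measure Ω)
    (r : ℝ≥0) : Prop :=
  ∃ c : ℝ≥0, ∀ σ : List (Task V), A.expectedCost P σ ≤ r * optCost v₀ σ + c

end MTS

/-!
A finite metric space on `n` points contains a hierarchically separated subset of at least `√n`
points, so it suffices to construct random task sequences on such sets that are expensive for every
online algorithm and cheap in the long run for the offline optimum. This goes by induction on the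
levels. Suppose that each child `A i` of a set of diameter `D` carries an adversary of ratio `r i`.
The adversary for their union flips a fair coin for every child and attacks the selected children
one after the other. An online algorithm cannot foresee whether its own child is attacked, and
leaving costs about `D`, so that it pays half of what it would pay inside the child.

Offline, the coins of `n` rounds are seen in advance. They form an independent word of `n` coins for
each child, telling in which rounds the child is attacked. The offline player lives in a child `i₀`
and moves for the `n` rounds to another child if the word of that child is exceptionally light,
resuming there where it left off. If the children in `J` have a ratio of at least `s`, this raises
the ratio from `r i₀` to `r i₀ + Ω(log #J)`, up to a loss that is exponentially small in `r i₀ - s`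
when this difference is large. Taking the best initial segment `J` of the children, ordered by
decreasing ratio, the new ratio `r'` satisfies `∑ i, exp (C * r i) ≤ exp (C * r')`. Hence a
hierarchically separated set with `N` points has an adversary of ratio at least `log N / C`.
-/

namespace MTS

open scoped Finset

section Expectation

variable {α β ι M N : Type*}

/-- The expectation of `f` under the discrete distribution `p`. -/
noncomputable def expect (p : PMF α) (f : α → ℝ≥0∞) : ℝ≥0∞ := ∑' x, p x * f x

theorem expect_mono (p : PMF α) {f g : α → ℝ≥0∞} (h : ∀ x, f x ≤ g x) : expect p f ≤ expect p g :=
  ENNReal.tsum_le_tsum fun x => mul_le_mul_right (h x) _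

theorem expect_add (p : PMF α) (f g : α → ℝ≥0∞) :
    expect p (fun x => f x + g x) = expect p f + expect p g := by
  simp only [expect, mul_add, ENNReal.tsum_add]

theorem expect_const (p : PMF α) (c : ℝ≥0∞) : expect p (fun _ => c) = c := by
  simp only [expect, ENNReal.tsum_mul_right, p.tsum_coe, one_mul]

theorem expect_const_mul (p : PMF α) (c : ℝ≥0∞) (f : α → ℝ≥0∞) :
    expect p (fun x => c * f x) = c * expect p f := by
  simp only [expect, mul_left_comm _ c, ENNReal.tsum_mul_left]

theorem expect_sum (p : PMF α) (s : Finset ι) (f : ι → α → ℝ≥0∞) :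
    expect p (fun x => ∑ i ∈ s, f i x) = ∑ i ∈ s, expect p (f i) := by
  simp only [expect, Finset.mul_sum]
  exact Summable.tsum_finsetSum fun _ _ => ENNReal.summable

theorem expect_pure (a : α) (f : α → ℝ≥0∞) : expect (PMF.pure a) f = f a := by
  classical
  rw [expect, tsum_eq_single a fun b hb => by simp [hb], PMF.pure_apply, if_pos rfl, one_mul]

theorem expect_bind (p : PMF α) (k : α → PMF β) (f : β → ℝ≥0∞) :
    expect (p.bind k) f = expect p fun x => expect (k x) f := by
  simp only [expect, PMF.bind_apply, ← ENNReal.tsum_mul_right, ← ENNReal.tsum_mul_left]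
  rw [ENNReal.tsum_comm]
  simp only [mul_assoc]

theorem expect_map (p : PMF α) (k : α → β) (f : β → ℝ≥0∞) :
    expect (p.map k) f = expect p fun x => f (k x) := by
  rw [PMF.map, expect_bind]
  simp only [Function.comp, expect_pure]

theorem expect_uniformOfFintype [Fintype α] [Nonempty α] (f : α → ℝ≥0∞) :
    expect (PMF.uniformOfFintype α) f = (Fintype.card α : ℝ≥0∞)⁻¹ * ∑ x, f x := by
  simp only [expect, PMF.uniformOfFintype_apply, tsum_fintype, Finset.mul_sum]

/-- Convolution: `p * q` is the distribution of `x * y` for independent samples `x` of `p` and `y`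
of `q`. In a free monoid this concatenates independent random sequences, and `p ^ n` is the
concatenation of `n` independent samples of `p`. -/
noncomputable instance convolution [Monoid M] : Monoid (PMF M) where
  mul p q := p.bind fun x => q.map (x * ·)
  one := PMF.pure 1
  one_mul p := by
    change (PMF.pure 1).bind (fun x => p.map (x * ·)) = p
    simp only [PMF.pure_bind, one_mul]
    exact PMF.map_id p
  mul_one p := by
    change p.bind (fun x => (PMF.pure 1).map (x * ·)) = p
    simp only [PMF.pure_map, mul_one, PMF.bind_pure]
  mul_assoc p q s := by
    change (p.bind fun x => q.map (x * ·)).bind (fun x => s.map (x * ·)) =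
      p.bind fun x => (q.bind fun y => s.map (y * ·)).map (x * ·)
    simp only [PMF.bind_bind, PMF.bind_map, PMF.map_bind, PMF.map_comp, Function.comp_def,
      mul_assoc]

theorem mul_eq_bind [Monoid M] (p q : PMF M) : p * q = p.bind fun x => q.map (x * ·) := rfl

theorem one_eq_pure [Monoid M] : (1 : PMF M) = PMF.pure 1 := rfl

theorem expect_one [Monoid M] (f : M → ℝ≥0∞) : expect 1 f = f 1 := expect_pure 1 f

theorem expect_mul [Monoid M] (p q : PMF M) (f : M → ℝ≥0∞) :
    expect (p * q) f = expect p fun x => expect q fun y => f (x * y) := by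
  simp only [mul_eq_bind, expect_bind, expect_map]

theorem bind_mul_bind [Monoid M] (p : PMF α) (q : PMF β) (k : α → PMF M) (l : β → PMF M) :
    p.bind k * q.bind l = p.bind fun x => q.bind fun y => k x * l y := by
  simp only [mul_eq_bind, PMF.bind_bind, PMF.map_bind]
  congr 1
  funext x
  exact PMF.bind_comm _ _ _

/-- Sampling an index from a product distribution and then from the indexed distributions, which
are multiplicative in the index. -/
noncomputable def bindHom [Monoid M] [Monoid N] (φ : N →* PMF M) : PMF N →* PMF M where
  toFun p := p.bind φ
  map_one' := by rw [one_eq_pure, PMF.pure_bind, map_one]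
  map_mul' p q := by
    rw [bind_mul_bind]
    simp only [mul_eq_bind, PMF.bind_bind, PMF.bind_map, Function.comp_def, map_mul]

/-- The pushforward of distributions along a monoid homomorphism. -/
noncomputable def mapHom [Monoid M] [Monoid N] (φ : N →* M) : PMF N →* PMF M where
  toFun p := p.map φ
  map_one' := by rw [one_eq_pure, PMF.pure_map, map_one, one_eq_pure]
  map_mul' p q := by
    simp only [mul_eq_bind, PMF.map_bind, PMF.bind_map, PMF.map_comp, Function.comp_def, map_mul]

theorem mapHom_apply [Monoid M] [Monoid N] (φ : N →* M) (p : PMF N) : mapHom φ p = p.map φ := rfl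

theorem bind_pow [Monoid M] (p : PMF α) (k : α → PMF M) (n : ℕ) :
    p.bind k ^ n = ((p.map FreeMonoid.of) ^ n).bind (FreeMonoid.lift k) := by
  have h : p.bind k = bindHom (FreeMonoid.lift k) (p.map FreeMonoid.of) := by
    simp only [bindHom, MonoidHom.coe_mk, OneHom.coe_mk, PMF.bind_map, Function.comp_def,
      FreeMonoid.lift_eval_of]
  rw [h, ← map_pow]
  rfl

theorem expect_pow_sum (p : PMF α) (f : α → ℝ≥0∞) (n : ℕ) :
    expect ((p.map FreeMonoid.of) ^ n) (fun w => (w.toList.map f).sum) = n * expect p f := by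
  induction n with
  | zero => simp [expect_one]
  | succ n ih =>
    simp only [pow_succ', expect_mul, expect_map, FreeMonoid.toList_mul, FreeMonoid.toList_of,
      List.singleton_append, List.map_cons, List.sum_cons, expect_add, expect_const, ih]
    push_cast
    ring

theorem uniformOfFintype_fin_succ [Fintype α] [Nonempty α] (n : ℕ) :
    PMF.uniformOfFintype (Fin (n + 1) → α) = (PMF.uniformOfFintype α).bind fun a =>
      (PMF.uniformOfFintype (Fin n → α)).map fun x => Fin.cons a x := by
  classical
  ext z
  have hcons (a : α) (x : Fin n → α) : (z = Fin.cons a x) ↔ z 0 = a ∧ Fin.tail z = x := by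
    rw [← Fin.cons_self_tail z, Fin.cons_inj, Fin.cons_zero, Fin.tail_cons]
  simp only [PMF.bind_apply, PMF.map_apply, PMF.uniformOfFintype_apply, tsum_fintype, hcons,
    ite_and, Finset.sum_ite_eq, Finset.mem_univ, if_true, Finset.sum_ite_irrel,
    Finset.sum_const_zero, mul_ite, mul_zero, Fintype.card_fun, Fintype.card_fin, pow_succ']
  push_cast
  exact ENNReal.mul_inv (.inr (by simp)) (.inl (by simp))

theorem uniformOfFintype_bind_pow [Monoid M] [Fintype α] [Nonempty α] (k : α → PMF M) (n : ℕ) :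
    (PMF.uniformOfFintype α).bind k ^ n =
      (PMF.uniformOfFintype (Fin n → α)).bind fun x => (List.ofFn fun t => k (x t)).prod := by
  induction n with
  | zero => simp [PMF.bind_const]
  | succ n ih =>
    simp only [pow_succ', ih, bind_mul_bind, uniformOfFintype_fin_succ, PMF.bind_bind, PMF.bind_map,
      Function.comp_def, List.ofFn_succ, Fin.cons_zero, Fin.cons_succ, List.prod_cons]

end Expectation

section Costs

variable {V : Type*} [MetricSpace V]

open Classical in
/-- The cost charged inside `A` for one step from `x` to `y` with task `t`: leaving `A` is charged
`γ`, and everything that starts outside `A` is free. -/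
noncomputable def stepCost (A : Finset V) (γ : ℝ≥0∞) (x y : V) (t : Task V) : ℝ≥0∞ :=
  if x ∈ A then if y ∈ A then edist x y + t y else γ else 0

/-- The cost charged inside `A` to the deterministic online algorithm `g` on a task sequence. -/
noncomputable def localCost (A : Finset V) (γ : ℝ≥0∞) : List (Task V) → (List (Task V) → V) → ℝ≥0∞
  | [], _ => 0
  | t :: σ, g => stepCost A γ (g []) (g [t]) t + localCost A γ σ fun τ => g (t :: τ)

/-- The optimal offline cost of serving a task sequence inside `A` from the initial state `u`. -/
noncomputable def localOptCost (A : Finset V) : List (Task V) → V → ℝ≥0∞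
  | [], _ => 0
  | t :: σ, u => ⨅ v ∈ A, (edist u v + t v + localOptCost A σ v)

open Classical in
/-- The task that agrees with `t` on `A` and is free elsewhere. -/
noncomputable def restrict (A : Finset V) (t : Task V) : Task V := fun v => if v ∈ A then t v else 0

theorem localCost_append (A : Finset V) (γ : ℝ≥0∞) (σ τ : List (Task V))
    (g : List (Task V) → V) :
    localCost A γ (σ ++ τ) g = localCost A γ σ g + localCost A γ τ fun ρ => g (σ ++ ρ) := by
  induction σ generalizing g with
  | nil => simp [localCost]
  | cons t σ ih => simp only [List.cons_append, localCost, ih, add_assoc]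

theorem stepCost_mono {A : Finset V} {γ γ' : ℝ≥0∞} (h : γ ≤ γ') (x y : V) (t : Task V) :
    stepCost A γ x y t ≤ stepCost A γ' x y t := by
  unfold stepCost; split_ifs <;> first | exact h | exact le_rfl

theorem localCost_mono {A : Finset V} {γ γ' : ℝ≥0∞} (h : γ ≤ γ') (σ : List (Task V))
    (g : List (Task V) → V) : localCost A γ σ g ≤ localCost A γ' σ g := by
  induction σ generalizing g with
  | nil => exact le_rfl
  | cons t σ ih => exact add_le_add (stepCost_mono h _ _ _) (ih _)

open Classical in
theorem localCost_add_le {A : Finset V} (γ c : ℝ≥0∞) (σ : List (Task V))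
    (g : List (Task V) → V) (hg : g [] ∈ A) :
    localCost A γ σ g + (if g σ ∈ A then 0 else c) ≤ localCost A (γ + c) σ g := by
  induction σ generalizing g with
  | nil => simp [localCost, hg]
  | cons t σ ih =>
    simp only [localCost]
    by_cases h : g [t] ∈ A
    · rw [add_assoc]
      exact add_le_add (stepCost_mono le_self_add _ _ _) (ih (fun τ => g (t :: τ)) h)
    · have hstep : stepCost A γ (g []) (g [t]) t + (if g (t :: σ) ∈ A then 0 else c) ≤
          stepCost A (γ + c) (g []) (g [t]) t := by
        simp only [stepCost, hg, h, if_true, if_false]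
        split_ifs <;> simp
      rw [add_right_comm]
      exact add_le_add hstep (localCost_mono le_self_add _ _)

theorem le_localCost_of_notMem {A : Finset V} (γ : ℝ≥0∞) (σ : List (Task V))
    (g : List (Task V) → V) (hg : g [] ∈ A) (hσ : g σ ∉ A) : γ ≤ localCost A γ σ g := by
  have := localCost_add_le 0 γ σ g hg
  rw [if_neg hσ, zero_add] at this
  exact le_add_self.trans this

theorem localCost_le_of_subset {A X : Finset V} {γ : ℝ≥0∞} (hAX : A ⊆ X)
    (hsep : ∀ x ∈ A, ∀ y ∈ X, y ∉ A → γ ≤ edist x y) (σ : List (Task V))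
    (g : List (Task V) → V) : localCost A γ σ g ≤ localCost X γ σ g := by
  induction σ generalizing g with
  | nil => exact le_rfl
  | cons t σ ih =>
    refine add_le_add ?_ (ih _)
    unfold stepCost
    by_cases hx : g [] ∈ A
    · rw [if_pos hx, if_pos (hAX hx)]
      split_ifs with hyA hyX hyX
      · exact le_rfl
      · exact absurd (hAX hyA) hyX
      · exact (hsep _ hx _ hyX hyA).trans le_self_add
      · exact le_rfl
    · rw [if_neg hx]
      exact zero_le

theorem localCost_map_restrict (A : Finset V) (γ : ℝ≥0∞) (σ : List (Task V))
    (g : List (Task V) → V) :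
    localCost A γ (σ.map (restrict A)) g = localCost A γ σ fun τ => g (τ.map (restrict A)) := by
  induction σ generalizing g with
  | nil => rfl
  | cons t σ ih =>
    simp only [List.map_cons, localCost, ih, List.map_nil]
    congr 1
    unfold stepCost restrict
    split_ifs <;> rfl

theorem localOptCost_le_append (A : Finset V) (σ τ : List (Task V)) (u : V) :
    localOptCost A σ u ≤ localOptCost A (σ ++ τ) u := by
  induction σ generalizing u with
  | nil => exact zero_le
  | cons t σ ih => exact iInf₂_mono fun v _ => add_le_add le_rfl (ih v)

theorem localOptCost_le_edist_add (A : Finset V) (σ : List (Task V)) (u v : V) :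
    localOptCost A σ u ≤ edist u v + localOptCost A σ v := by
  cases σ with
  | nil => exact zero_le
  | cons t σ =>
    simp only [localOptCost, ENNReal.add_iInf]
    refine iInf₂_mono fun w _ => ?_
    rw [← add_assoc, ← add_assoc]
    gcongr
    exact edist_triangle _ _ _

end Costs

section Adversary

variable {V : Type*} [MetricSpace V] {A : Finset V} {p : PMF (FreeMonoid (Task V))}
  {a γ o : ℝ≥0∞}

/-- A random task sequence `p` that costs every online algorithm starting in `A` at least `a` in
expectation, when leaving `A` is charged `γ`, while independent repetitions of `p` can be served
offline inside `A` at an average cost of `o`. -/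
structure IsAdversary (A : Finset V) (p : PMF (FreeMonoid (Task V))) (a γ o : ℝ≥0∞) : Prop where
  online : ∀ g : List (Task V) → V, g [] ∈ A → a ≤ expect p fun σ => localCost A γ σ.toList g
  offline : ∃ c : ℝ≥0∞, c ≠ ∞ ∧ ∀ (T : ℕ), ∀ u ∈ A,
    expect (p ^ T) (fun σ => localOptCost A σ.toList u) ≤ T * o + c

theorem IsAdversary.mono {γ' o' : ℝ≥0∞} (h : IsAdversary A p a γ o) (hγ : γ ≤ γ') (ho : o ≤ o') :
    IsAdversary A p a γ' o' := by
  refine ⟨fun g hg => (h.online g hg).trans (expect_mono _ fun σ => localCost_mono hγ _ _), ?_⟩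
  obtain ⟨c, hc, H⟩ := h.offline
  exact ⟨c, hc, fun T u hu => (H T u hu).trans (by gcongr)⟩

open Classical in
theorem isAdversary_singleton (v : V) (a : ℝ≥0∞) :
    IsAdversary {v} (PMF.pure (.of fun w => if w = v then a else 0)) a a a := by
  constructor
  · intro g hg
    rw [Finset.mem_singleton] at hg
    simp only [expect_pure, FreeMonoid.toList_of, localCost, stepCost, hg, Finset.mem_singleton,
      if_true, add_zero]
    split_ifs
    · exact le_add_self
    · exact le_rfl
  · refine ⟨0, ENNReal.zero_ne_top, fun T u hu => ?_⟩
    rw [Finset.mem_singleton] at hu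
    subst hu
    rw [add_zero]
    induction T with
    | zero => simp [expect_one, localOptCost]
    | succ T ih =>
      simp only [pow_succ', expect_mul, expect_pure, FreeMonoid.toList_mul, FreeMonoid.toList_of,
        List.singleton_append, localOptCost, Finset.mem_singleton, iInf_iInf_eq_left, edist_self,
        zero_add, if_true, expect_add, expect_const]
      push_cast
      rw [add_mul, one_mul, add_comm]
      gcongr

theorem IsAdversary.online_pow (h : IsAdversary A p a γ o) (N : ℕ) (g : List (Task V) → V)
    (hg : g [] ∈ A) :
    N * a ≤ expect (p ^ N) fun σ => localCost A (γ + N * a) σ.toList g := by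
  classical
  induction N generalizing g with
  | zero => simp
  | succ N ih =>
    have hmono {c : ℝ≥0∞} (hc : c ≤ N * a) : γ + c ≤ γ + (N + 1 : ℕ) * a := by
      gcongr
      exact hc.trans (by gcongr; simp)
    have hprefix (τ : FreeMonoid (Task V)) : localCost A γ τ.toList g + N * a ≤
        expect (p ^ N) fun σ => localCost A (γ + (N + 1 : ℕ) * a) (τ * σ).toList g := by
      simp only [FreeMonoid.toList_mul, localCost_append, expect_add, expect_const]
      have hexit := (localCost_add_le γ (N * a) τ.toList g hg).trans
        (localCost_mono (hmono le_rfl) _ _)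
      by_cases hτ : g τ.toList ∈ A
      · rw [if_pos hτ, add_zero] at hexit
        refine add_le_add hexit ((ih (fun ρ => g (τ.toList ++ ρ)) (by simpa using hτ)).trans ?_)
        exact expect_mono _ fun σ => localCost_mono (hmono le_rfl) _ _
      · rw [if_neg hτ] at hexit
        exact hexit.trans le_self_add
    calc ((N + 1 : ℕ) : ℝ≥0∞) * a = a + N * a := by push_cast; ring
      _ ≤ expect p fun τ => localCost A γ τ.toList g + N * a := by
          rw [expect_add, expect_const]
          gcongr
          exact h.online g hg
      _ ≤ _ := by
          rw [pow_succ', expect_mul]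
          exact expect_mono _ hprefix

theorem IsAdversary.pow (h : IsAdversary A p a γ o) (N : ℕ) :
    IsAdversary A (p ^ N) (N * a) (γ + N * a) (N * o) := by
  obtain ⟨c, hc, H⟩ := h.offline
  refine ⟨h.online_pow N, c, hc, fun T u hu => ?_⟩
  rw [← pow_mul]
  refine (H _ u hu).trans (le_of_eq ?_)
  push_cast
  ring

theorem expect_pow_localOptCost_mono (p : PMF (FreeMonoid (Task V))) (u : V) :
    Monotone fun T => expect (p ^ T) fun σ => localOptCost A σ.toList u := by
  refine monotone_nat_of_le_succ fun T => ?_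
  simp only [pow_succ, expect_mul]
  refine expect_mono _ fun σ => ?_
  rw [← expect_const p (localOptCost A σ.toList u)]
  exact expect_mono _ fun τ => localOptCost_le_append _ _ _ _

theorem exists_offline_bound_of_pow {c : ℝ≥0∞} (ho : o ≠ ∞) (hc : c ≠ ∞) {n : ℕ} (hn : 0 < n)
    (H : ∀ (K : ℕ), ∀ u ∈ A,
      expect ((p ^ n) ^ K) (fun σ => localOptCost A σ.toList u) ≤ K * (n * o) + c) :
    ∃ c : ℝ≥0∞, c ≠ ∞ ∧ ∀ (T : ℕ), ∀ u ∈ A,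
      expect (p ^ T) (fun σ => localOptCost A σ.toList u) ≤ T * o + c := by
  refine ⟨n * o + c, by finiteness, fun T u hu => ?_⟩
  calc expect (p ^ T) (fun σ => localOptCost A σ.toList u)
      ≤ expect (p ^ (n * (T / n + 1))) (fun σ => localOptCost A σ.toList u) :=
        expect_pow_localOptCost_mono p u (Nat.lt_mul_div_succ T hn).le
    _ ≤ (T / n + 1 : ℕ) * (n * o) + c := by rw [pow_mul]; exact H _ u hu
    _ = ((T / n * n : ℕ) : ℝ≥0∞) * o + (n * o + c) := by push_cast; ring
    _ ≤ T * o + (n * o + c) := by gcongr; exact Nat.div_mul_le_self T n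

end Adversary

section Star

variable {V : Type*} [MetricSpace V] {ι : Type*}

/-- The random task sequence of a word of children `A i`: every letter `i` of the word contributes
an independent sample of `p i`, made free outside `A i`. -/
noncomputable def attack (A : ι → Finset V) (p : ι → PMF (FreeMonoid (Task V))) :
    FreeMonoid ι →* PMF (FreeMonoid (Task V)) :=
  FreeMonoid.lift fun i => (p i).map (FreeMonoid.map (restrict (A i)))

/-- The adversary that flips a fair coin for every child `A i` and attacks in turn, with `p i`,
the children that were selected. -/
noncomputable def star [Fintype ι] (A : ι → Finset V) (p : ι → PMF (FreeMonoid (Task V))) :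
    PMF (FreeMonoid (Task V)) :=
  (PMF.uniformOfFintype (Finset ι)).bind fun c => attack A p (FreeMonoid.ofList c.toList)

theorem expect_uniformOfFintype_finset_ite [Fintype ι] [DecidableEq ι] (i : ι) (a : ℝ≥0∞) :
    expect (PMF.uniformOfFintype (Finset ι)) (fun c => if i ∈ c then a else 0) = a / 2 := by
  set U := PMF.uniformOfFintype (Finset ι)
  have hcompl : expect U (fun c => if i ∈ c then a else 0) =
      expect U fun c => if i ∈ c then 0 else a := by
    rw [expect_uniformOfFintype, expect_uniformOfFintype]
    congr 1
    exact Fintype.sum_equiv (compl_involutive (α := Finset ι)).toPerm _ _ fun c => by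
      by_cases h : i ∈ c <;> simp [h]
  have hadd : expect U (fun c => if i ∈ c then a else 0) * 2 = a := by
    rw [mul_two]
    nth_rewrite 2 [hcompl]
    rw [← expect_add]
    refine Eq.trans (congrArg _ (funext fun c => ?_)) (expect_const U a)
    split_ifs <;> simp
  rw [ENNReal.eq_div_iff two_ne_zero ENNReal.ofNat_ne_top, mul_comm, hadd]

theorem le_expect_attack_of_mem {A : ι → Finset V} {p : ι → PMF (FreeMonoid (Task V))}
    {a γ : ℝ≥0∞} (haγ : a ≤ γ) {i : ι} (hp : ∀ g : List (Task V) → V, g [] ∈ A i →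
      a ≤ expect (p i) fun σ => localCost (A i) γ σ.toList g)
    (w : FreeMonoid ι) (hi : i ∈ w) (g : List (Task V) → V) (hg : g [] ∈ A i) :
    a ≤ expect (attack A p w) fun σ => localCost (A i) γ σ.toList g := by
  induction w using FreeMonoid.inductionOn' generalizing g with
  | one => exact absurd hi FreeMonoid.notMem_one
  | of_mul j w ih =>
    simp only [attack, map_mul, FreeMonoid.lift_eval_of, expect_mul, expect_map,
      FreeMonoid.toList_mul, FreeMonoid.toList_map, localCost_append] at ih ⊢
    by_cases hj : j = i
    · subst hj
      refine (hp (fun τ => g (τ.map (restrict (A j)))) hg).trans (expect_mono _ fun τ => ?_)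
      rw [expect_add, expect_const, localCost_map_restrict]
      exact le_self_add
    · rw [← expect_const (p j) a]
      refine expect_mono _ fun τ => ?_
      rw [expect_add, expect_const]
      by_cases hτ : g (τ.toList.map (restrict (A j))) ∈ A i
      · have hiw : i ∈ w := by simpa [Ne.symm hj] using hi
        exact (ih hiw (fun ρ => g (τ.toList.map (restrict (A j)) ++ ρ)) (by simpa using hτ)).trans
          le_add_self
      · exact (haγ.trans (le_localCost_of_notMem γ _ g hg hτ)).trans le_self_add

theorem half_le_expect_star [Fintype ι] {A : ι → Finset V} {p : ι → PMF (FreeMonoid (Task V))}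
    {X : Finset V} (hX : ∀ x, x ∈ X ↔ ∃ i, x ∈ A i) {a γ : ℝ≥0∞} (haγ : a ≤ γ)
    (hp : ∀ i, ∀ g : List (Task V) → V, g [] ∈ A i →
      a ≤ expect (p i) fun σ => localCost (A i) γ σ.toList g)
    (hsep : ∀ i j, i ≠ j → ∀ x ∈ A i, ∀ y ∈ A j, γ ≤ edist x y)
    (g : List (Task V) → V) (hg : g [] ∈ X) :
    a / 2 ≤ expect (star A p) fun σ => localCost X γ σ.toList g := by
  classical
  obtain ⟨i, hi⟩ := (hX _).1 hg
  rw [star, expect_bind, ← expect_uniformOfFintype_finset_ite i a]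
  refine expect_mono _ fun c => ?_
  split_ifs with hc
  · refine (le_expect_attack_of_mem haγ (hp i) _ (Finset.mem_toList.2 hc) g hi).trans
      (expect_mono _ fun σ => ?_)
    refine localCost_le_of_subset (fun x hx => (hX x).2 ⟨i, hx⟩) (fun x hx y hy hyA => ?_) _ g
    obtain ⟨j, hj⟩ := (hX y).1 hy
    exact hsep i j (fun h => hyA (h ▸ hj)) x hx y hj
  · exact zero_le

end Star

section Phases

variable {V ι Γ : Type*}

/-- The tasks of a sequence of attacks, every one tagged with the attacked child. -/
noncomputable def taggedTasks (A : ι → Finset V) :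
    FreeMonoid (ι × Task V) →* FreeMonoid (Task V) :=
  FreeMonoid.map fun x => restrict (A x.1) x.2

/-- The tasks in a tagged sequence that attack the child `j`. -/
noncomputable def tasksAt [DecidableEq ι] (j : ι) :
    FreeMonoid (ι × Task V) →* FreeMonoid (Task V) :=
  FreeMonoid.lift fun x => if x.1 = j then FreeMonoid.of x.2 else 1

/-- The tasks of a sequence of phases. The first component of a phase is the child in which the
offline player stays during the phase, the second one is the tagged sequence of the attacks. -/
noncomputable def phaseTasks (A : ι → Finset V) :
    FreeMonoid (ι × FreeMonoid (ι × Task V)) →* FreeMonoid (Task V) :=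
  FreeMonoid.lift fun q => taggedTasks A q.2

/-- The attacks on the child `j` in those phases during which the offline player stays there. -/
noncomputable def selectedTasks [DecidableEq ι] (j : ι) :
    FreeMonoid (ι × FreeMonoid (ι × Task V)) →* FreeMonoid (Task V) :=
  FreeMonoid.lift fun q => if q.1 = j then tasksAt j q.2 else 1

/-- The attacks of a random task sequence as in `attack`, every task tagged with the attacked
child. -/
noncomputable def taggedAttack (p : ι → PMF (FreeMonoid (Task V))) :
    FreeMonoid ι →* PMF (FreeMonoid (ι × Task V)) :=
  FreeMonoid.lift fun i => (p i).map (FreeMonoid.map fun t => (i, t))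

/-- The random phases of a sequence over `Γ`: in the phase of `c` the children in the word `w c` are
attacked while the offline player stays in the child `side c`. -/
noncomputable def phases (p : ι → PMF (FreeMonoid (Task V))) (w : Γ → FreeMonoid ι)
    (side : Γ → ι) : FreeMonoid Γ →* PMF (FreeMonoid (ι × FreeMonoid (ι × Task V))) :=
  FreeMonoid.lift fun c => (taggedAttack p (w c)).map fun l => FreeMonoid.of (side c, l)

variable (p : ι → PMF (FreeMonoid (Task V))) (w : Γ → FreeMonoid ι) (side : Γ → ι)

theorem map_taggedAttack_taggedTasks (A : ι → Finset V) (l : FreeMonoid ι) :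
    (taggedAttack p l).map (taggedTasks A) = attack A p l := by
  have h : (mapHom (taggedTasks A)).comp (taggedAttack p) = attack A p :=
    FreeMonoid.hom_eq fun i => by
      simp only [MonoidHom.comp_apply, mapHom_apply, taggedAttack, attack, FreeMonoid.lift_eval_of,
        PMF.map_comp, taggedTasks, ← MonoidHom.coe_comp, ← FreeMonoid.map_comp]
      rfl
  exact DFunLike.congr_fun h l

theorem map_taggedAttack_tasksAt [DecidableEq ι] (j : ι) (l : FreeMonoid ι) :
    (taggedAttack p l).map (tasksAt j) = p j ^ l.toList.count j := by
  induction l using FreeMonoid.inductionOn' with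
  | one => simp only [← mapHom_apply, map_one]; rfl
  | of_mul i l ih =>
    have hi : (p i).map (tasksAt j ∘ FreeMonoid.map fun t => (i, t)) =
        p j ^ if i = j then 1 else 0 := by
      split_ifs with hij
      · subst hij
        have hid : (tasksAt i).comp (FreeMonoid.map fun t : Task V => (i, t)) = .id _ :=
          FreeMonoid.hom_eq fun t => by simp [tasksAt]
        rw [pow_one, ← MonoidHom.coe_comp, hid]
        exact PMF.map_id _
      · have hone : (tasksAt j).comp (FreeMonoid.map fun t : Task V => (i, t)) = 1 :=
          FreeMonoid.hom_eq fun t => by simp [tasksAt, hij]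
        rw [pow_zero, ← MonoidHom.coe_comp, hone]
        exact PMF.map_const _ _
    rw [← mapHom_apply] at ih ⊢
    rw [map_mul, map_mul, ih, mapHom_apply, taggedAttack, FreeMonoid.lift_eval_of, PMF.map_comp, hi,
      ← pow_add, FreeMonoid.toList_of_mul, List.count_cons, add_comm]
    simp only [beq_iff_eq]

theorem map_phases_phaseTasks (A : ι → Finset V) (cs : FreeMonoid Γ) :
    (phases p w side cs).map (phaseTasks A) = FreeMonoid.lift (fun c => attack A p (w c)) cs := by
  have h : (mapHom (phaseTasks A)).comp (phases p w side) =
      FreeMonoid.lift fun c => attack A p (w c) :=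
    FreeMonoid.hom_eq fun c => by
      simp only [MonoidHom.comp_apply, mapHom_apply, phases, FreeMonoid.lift_eval_of, PMF.map_comp,
        ← map_taggedAttack_taggedTasks]
      rfl
  exact DFunLike.congr_fun h cs

theorem map_phases_selectedTasks [DecidableEq ι] (j : ι) (cs : FreeMonoid Γ) :
    (phases p w side cs).map (selectedTasks j) =
      p j ^ (cs.toList.map fun c => if side c = j then (w c).toList.count j else 0).sum := by
  induction cs using FreeMonoid.inductionOn' with
  | one => simp only [← mapHom_apply, map_one]; rfl
  | of_mul c cs ih =>
    have hc : (phases p w side (FreeMonoid.of c)).map (selectedTasks j) =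
        p j ^ if side c = j then (w c).toList.count j else 0 := by
      have hsel : (selectedTasks (V := V) j ∘ fun l => FreeMonoid.of (side c, l)) = fun l =>
          if side c = j then tasksAt j l else 1 := by
        funext l
        simp [selectedTasks]
      rw [phases, FreeMonoid.lift_eval_of, PMF.map_comp, hsel]
      split_ifs
      · exact map_taggedAttack_tasksAt p j _
      · exact PMF.map_const _ _
    rw [← mapHom_apply] at ih hc ⊢
    rw [map_mul, map_mul, ih, hc, FreeMonoid.toList_of_mul, List.map_cons, List.sum_cons, pow_add]

theorem expect_phases_sum (f : ι → ℝ≥0∞) (cs : FreeMonoid Γ) :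
    expect (phases p w side cs) (fun ps => (ps.toList.map fun q => f q.1).sum) =
      (cs.toList.map fun c => f (side c)).sum := by
  induction cs using FreeMonoid.inductionOn' with
  | one => simp [expect_one]
  | of_mul c cs ih =>
    rw [map_mul, expect_mul, phases, FreeMonoid.lift_eval_of, expect_map]
    simp only [FreeMonoid.toList_of_mul, List.map_cons, List.sum_cons, expect_add, expect_const]
    rw [← phases, ih]

/-- The rounds in which the child `i` is attacked. -/
def hitTimes {τ : Type*} [Fintype τ] [DecidableEq ι] (c : τ → Finset ι) (i : ι) : Finset τ :=
  {t | i ∈ c t}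

theorem count_prod_ofFn_toList [DecidableEq ι] {n : ℕ} (c : Fin n → Finset ι) (i : ι) :
    (List.ofFn fun t => FreeMonoid.ofList (c t).toList).prod.toList.count i = #(hitTimes c i) := by
  simp only [FreeMonoid.toList_prod, List.count_flatten, List.map_ofFn, List.sum_ofFn,
    Function.comp_apply, FreeMonoid.toList_ofList, (Finset.nodup_toList _).count,
    Finset.mem_toList, hitTimes, Finset.card_filter]

theorem star_pow [Fintype ι] (A : ι → Finset V) (p : ι → PMF (FreeMonoid (Task V))) (n : ℕ) :
    star A p ^ n = (PMF.uniformOfFintype (Fin n → Finset ι)).bind fun c =>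
      attack A p (List.ofFn fun t => FreeMonoid.ofList (c t).toList).prod := by
  simp only [star, uniformOfFintype_bind_pow, map_list_prod, List.map_ofFn, Function.comp_def]

end Phases

section Offline

variable {V : Type*} [MetricSpace V] {ι : Type*} [DecidableEq ι]

theorem localOptCost_taggedTasks_mul_le {A : ι → Finset V} {X : Finset V} (hX : ∀ i, A i ⊆ X)
    (hdisj : ∀ i j, i ≠ j → Disjoint (A i) (A j)) (i : ι) (rest sel : FreeMonoid (Task V))
    (Q : ℝ≥0∞) (h : ∀ v ∈ A i, localOptCost X rest.toList v ≤ Q + localOptCost (A i) sel.toList v)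
    (l : FreeMonoid (ι × Task V)) {v : V} (hv : v ∈ A i) :
    localOptCost X (taggedTasks A l * rest).toList v ≤
      Q + localOptCost (A i) (tasksAt i l * sel).toList v := by
  induction l using FreeMonoid.inductionOn' generalizing v with
  | one => simpa using h v hv
  | of_mul x l ih =>
    obtain ⟨k, t⟩ := x
    have htagged : taggedTasks A (FreeMonoid.of (k, t) * l) * rest =
        FreeMonoid.of (restrict (A k) t) * (taggedTasks A l * rest) := by
      simp [taggedTasks, mul_assoc]
    have htasksAt : tasksAt i (FreeMonoid.of (k, t) * l) * sel =
        (if k = i then FreeMonoid.of t else 1) * (tasksAt i l * sel) := by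
      simp [tasksAt, mul_assoc]
    rw [htagged, htasksAt]
    simp only [FreeMonoid.toList_of_mul, localOptCost]
    by_cases hk : k = i
    · subst hk
      rw [if_pos rfl]
      simp only [FreeMonoid.toList_of_mul, localOptCost, ENNReal.add_iInf]
      refine le_iInf₂ fun w hw => (iInf₂_le w (hX k hw)).trans ?_
      rw [add_left_comm]
      simp only [restrict, if_pos hw]
      gcongr
      exact ih hw
    · rw [if_neg hk, one_mul]
      refine (iInf₂_le v (hX i hv)).trans ?_
      have hvk : v ∉ A k := fun hvk => Finset.disjoint_left.1 (hdisj k i hk) hvk hv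
      simp only [restrict, hvk, if_false, edist_self, zero_add, add_zero]
      exact ih hv

variable [Fintype ι]

theorem localOptCost_le_of_forall_update {A : ι → Finset V} {X : Finset V} {i₀ : ι}
    {D : ι → ℝ≥0∞} (hD : ∀ u : ι → V, (∀ j, u j ∈ A j) → ∀ i, edist (u i) (u i₀) ≤ D i)
    {rest : List (Task V)} {sel : ι → List (Task V)} {Q : ℝ≥0∞}
    (h : ∀ u : ι → V, (∀ j, u j ∈ A j) →
      localOptCost X rest (u i₀) ≤ Q + ∑ j, localOptCost (A j) (sel j) (u j))
    (i : ι) (u : ι → V) (hu : ∀ j, u j ∈ A j) {v : V} (hv : v ∈ A i) :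
    localOptCost X rest v ≤ D i + Q + ∑ j ∈ Finset.univ \ {i}, localOptCost (A j) (sel j) (u j) +
      localOptCost (A i) (sel i) v := by
  have hv' (j : ι) : Function.update u i v j ∈ A j := by
    by_cases hj : j = i
    · subst hj; simpa using hv
    · simpa [hj] using hu j
  have hrest := h _ hv'
  simp only [Function.apply_update fun j => localOptCost (A j) (sel j)] at hrest
  rw [Finset.sum_update_of_mem (Finset.mem_univ i)] at hrest
  have hmove := hD _ hv' i
  rw [Function.update_self] at hmove
  calc localOptCost X rest v
      ≤ D i + localOptCost X rest (Function.update u i v i₀) :=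
        (localOptCost_le_edist_add X _ v _).trans (by gcongr)
    _ ≤ D i + _ := add_le_add le_rfl hrest
    _ = _ := by ring

theorem localOptCost_phase_le {A : ι → Finset V} {X : Finset V} (hX : ∀ i, A i ⊆ X)
    (hdisj : ∀ i j, i ≠ j → Disjoint (A i) (A j)) {i₀ : ι} {D : ι → ℝ≥0∞}
    (hD : ∀ u : ι → V, (∀ j, u j ∈ A j) → ∀ i, edist (u i) (u i₀) ≤ D i)
    {rest : FreeMonoid (Task V)} {sel : ι → FreeMonoid (Task V)} {Q : ℝ≥0∞}
    (h : ∀ u : ι → V, (∀ j, u j ∈ A j) → localOptCost X rest.toList (u i₀) ≤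
      Q + ∑ j, localOptCost (A j) (sel j).toList (u j))
    (i : ι) (l : FreeMonoid (ι × Task V)) (u : ι → V) (hu : ∀ j, u j ∈ A j) :
    localOptCost X (taggedTasks A l * rest).toList (u i₀) ≤ 2 * D i + Q +
      ∑ j, localOptCost (A j) (Function.update sel i (tasksAt i l * sel i) j).toList (u j) := by
  have hreturn (v : V) (hv : v ∈ A i) :=
    localOptCost_le_of_forall_update hD h i u hu hv
  have hgo : edist (u i₀) (u i) ≤ D i := edist_comm (u i) (u i₀) ▸ hD u hu i
  simp only [Function.apply_update fun j (σ : FreeMonoid (Task V)) =>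
    localOptCost (A j) σ.toList (u j)]
  rw [Finset.sum_update_of_mem (Finset.mem_univ i)]
  calc localOptCost X (taggedTasks A l * rest).toList (u i₀)
      ≤ D i + localOptCost X (taggedTasks A l * rest).toList (u i) :=
        (localOptCost_le_edist_add X _ _ (u i)).trans (by gcongr)
    _ ≤ D i + _ := add_le_add le_rfl
        (localOptCost_taggedTasks_mul_le hX hdisj i rest (sel i) _ hreturn l (hu i))
    _ = _ := by ring

/-- The offline player returns to the child `i₀` after every phase and resumes in every child where
it left off. -/
theorem localOptCost_phaseTasks_le {A : ι → Finset V} {X : Finset V}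
    (hX : ∀ i, A i ⊆ X) (hdisj : ∀ i j, i ≠ j → Disjoint (A i) (A j)) {i₀ : ι} {D : ι → ℝ≥0∞}
    (hD : ∀ u : ι → V, (∀ j, u j ∈ A j) → ∀ i, edist (u i) (u i₀) ≤ D i)
    (ps : FreeMonoid (ι × FreeMonoid (ι × Task V))) (u : ι → V) (hu : ∀ i, u i ∈ A i) :
    localOptCost X (phaseTasks A ps).toList (u i₀) ≤
      (ps.toList.map fun q => 2 * D q.1).sum +
        ∑ j, localOptCost (A j) (selectedTasks j ps).toList (u j) := by
  induction ps using FreeMonoid.inductionOn' generalizing u with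
  | one => simp [localOptCost]
  | of_mul q ps ih =>
    obtain ⟨i, l⟩ := q
    have hsel : (fun j => selectedTasks j (FreeMonoid.of (i, l) * ps)) =
        Function.update (fun j => selectedTasks j ps) i (tasksAt i l * selectedTasks i ps) := by
      funext j
      rw [map_mul, selectedTasks, FreeMonoid.lift_eval_of]
      by_cases hj : j = i
      · subst hj; simp [selectedTasks]
      · simp [selectedTasks, hj, Ne.symm hj]
    have hphase := localOptCost_phase_le hX hdisj hD ih i l u hu
    simp only [← hsel] at hphase
    rwa [map_mul, phaseTasks, FreeMonoid.lift_eval_of, FreeMonoid.toList_of_mul, List.map_cons,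
      List.sum_cons]

variable {Γ : Type*}

theorem sum_natCast_mul_of_eq_side (m : Γ → ι → ℕ) (side : Γ → ι) (o : ι → ℝ≥0∞) (l : List Γ) :
    ∑ j, (((l.map fun x => if side x = j then m x j else 0).sum : ℕ) : ℝ≥0∞) * o j =
      (l.map fun x => (m x (side x) : ℝ≥0∞) * o (side x)).sum := by
  induction l with
  | nil => simp
  | cons x l ih =>
    simp only [List.map_cons, List.sum_cons, Nat.cast_add, add_mul, Finset.sum_add_distrib, ih,
      Nat.cast_ite, Nat.cast_zero, ite_mul, zero_mul, Finset.sum_ite_eq, Finset.mem_univ, if_true]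

theorem expect_lift_attack_le {A : ι → Finset V} {X : Finset V} (hX : ∀ i, A i ⊆ X)
    (hdisj : ∀ i j, i ≠ j → Disjoint (A i) (A j)) {i₀ : ι} {D : ι → ℝ≥0∞}
    (hD : ∀ u : ι → V, (∀ j, u j ∈ A j) → ∀ i, edist (u i) (u i₀) ≤ D i)
    {p : ι → PMF (FreeMonoid (Task V))} {o c : ι → ℝ≥0∞} {u : ι → V} (hu : ∀ i, u i ∈ A i)
    (hp : ∀ i (T : ℕ), expect (p i ^ T) (fun σ => localOptCost (A i) σ.toList (u i)) ≤
      T * o i + c i)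
    (w : Γ → FreeMonoid ι) (side : Γ → ι) (cs : FreeMonoid Γ) (v : V) :
    expect (FreeMonoid.lift (fun x => attack A p (w x)) cs)
        (fun σ => localOptCost X σ.toList v) ≤
      edist v (u i₀) + ∑ j, c j + (cs.toList.map fun x =>
        2 * D (side x) + (w x).toList.count (side x) * o (side x)).sum := by
  set m : ι → ℕ := fun j =>
    (cs.toList.map fun x => if side x = j then (w x).toList.count j else 0).sum with hm
  have hselected (j : ι) : expect (phases p w side cs)
      (fun ps => localOptCost (A j) (selectedTasks j ps).toList (u j)) ≤ m j * o j + c j := by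
    rw [← expect_map _ (selectedTasks j) fun σ => localOptCost (A j) σ.toList (u j),
      map_phases_selectedTasks]
    exact hp j _
  rw [← map_phases_phaseTasks p w side, expect_map]
  calc _ ≤ expect (phases p w side cs) fun ps => edist v (u i₀) +
        ((ps.toList.map fun q => 2 * D q.1).sum +
          ∑ j, localOptCost (A j) (selectedTasks j ps).toList (u j)) :=
        expect_mono _ fun ps => (localOptCost_le_edist_add X _ v (u i₀)).trans
          (add_le_add le_rfl (localOptCost_phaseTasks_le hX hdisj hD ps u hu))
    _ ≤ edist v (u i₀) +
        ((cs.toList.map fun x => 2 * D (side x)).sum + ∑ j, (m j * o j + c j)) := by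
        rw [expect_add, expect_const, expect_add, expect_phases_sum p w side (fun i => 2 * D i),
          expect_sum]
        gcongr with j
        exact hselected j
    _ = _ := by
        rw [Finset.sum_add_distrib, hm, sum_natCast_mul_of_eq_side, List.sum_map_add]
        ring

theorem expect_bind_attack_pow_le {A : ι → Finset V} {X : Finset V} (hX : ∀ i, A i ⊆ X)
    (hdisj : ∀ i j, i ≠ j → Disjoint (A i) (A j)) {i₀ : ι} {D : ι → ℝ≥0∞}
    (hD : ∀ u : ι → V, (∀ j, u j ∈ A j) → ∀ i, edist (u i) (u i₀) ≤ D i)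
    {p : ι → PMF (FreeMonoid (Task V))} {o c : ι → ℝ≥0∞} {u : ι → V} (hu : ∀ i, u i ∈ A i)
    (hp : ∀ i (T : ℕ), expect (p i ^ T) (fun σ => localOptCost (A i) σ.toList (u i)) ≤
      T * o i + c i)
    (w : Γ → FreeMonoid ι) (side : Γ → ι) (U : PMF Γ) (K : ℕ) (v : V) :
    expect ((U.bind fun x => attack A p (w x)) ^ K) (fun σ => localOptCost X σ.toList v) ≤
      K * expect U (fun x => 2 * D (side x) + (w x).toList.count (side x) * o (side x)) +
        (edist v (u i₀) + ∑ j, c j) := by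
  rw [bind_pow, expect_bind, ← expect_pow_sum, add_comm, ← expect_const (U.map FreeMonoid.of ^ K)
    (edist v (u i₀) + ∑ j, c j), ← expect_add]
  exact expect_mono _ fun cs => expect_lift_attack_le hX hdisj hD hu hp w side cs v

theorem exists_offline_bound_star {A : ι → Finset V} {X : Finset V}
    (hX : ∀ i, A i ⊆ X) (hne : ∀ i, (A i).Nonempty)
    (hdisj : ∀ i j, i ≠ j → Disjoint (A i) (A j)) {i₀ : ι} {D : ι → ℝ≥0∞}
    (hD : ∀ u : ι → V, (∀ j, u j ∈ A j) → ∀ i, edist (u i) (u i₀) ≤ D i)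
    {p : ι → PMF (FreeMonoid (Task V))} {o : ι → ℝ≥0∞}
    (hp : ∀ i, ∃ c : ℝ≥0∞, c ≠ ∞ ∧ ∀ (T : ℕ), ∀ u ∈ A i,
      expect (p i ^ T) (fun σ => localOptCost (A i) σ.toList u) ≤ T * o i + c)
    {ρ : ℝ≥0∞} (hρ : ρ ≠ ∞) {n : ℕ} (hn : 0 < n) (side : (Fin n → Finset ι) → ι)
    (hside : expect (PMF.uniformOfFintype (Fin n → Finset ι)) (fun c =>
      2 * D (side c) + #(hitTimes c (side c)) * o (side c)) ≤ n * ρ) :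
    ∃ c : ℝ≥0∞, c ≠ ∞ ∧ ∀ (T : ℕ), ∀ u ∈ X,
      expect (star A p ^ T) (fun σ => localOptCost X σ.toList u) ≤ T * ρ + c := by
  choose c hc hpc using hp
  choose u hu using hne
  refine exists_offline_bound_of_pow (c := ∑ v ∈ X, edist v (u i₀) + ∑ j, c j) hρ ?_ hn
    fun K v hv => ?_
  · exact ENNReal.add_ne_top.2 ⟨ENNReal.sum_ne_top.2 fun v _ => edist_ne_top _ _,
      ENNReal.sum_ne_top.2 fun j _ => hc j⟩
  rw [star_pow]
  refine (expect_bind_attack_pow_le hX hdisj hD hu (fun i T => hpc i T _ (hu i)) _ side _ K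
    v).trans ?_
  simp only [count_prod_ofFn_toList]
  gcongr
  exact Finset.single_le_sum (f := fun v => edist v (u i₀)) (fun _ _ => zero_le) hv

end Offline

section Words

variable {α ι τ : Type*} [Fintype τ] [DecidableEq ι]

theorem expect_uniformOfFintype_comp_equiv {β : Type*} [Fintype α] [Nonempty α] [Fintype β]
    [Nonempty β] (e : α ≃ β) (f : β → ℝ≥0∞) :
    expect (PMF.uniformOfFintype α) (fun x => f (e x)) = expect (PMF.uniformOfFintype β) f := by
  rw [expect_uniformOfFintype, expect_uniformOfFintype, Fintype.card_congr e, e.sum_comp f]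

theorem expect_uniformOfFintype_ofReal [Fintype α] [Nonempty α] {f : α → ℝ} (hf : ∀ x, 0 ≤ f x) :
    expect (PMF.uniformOfFintype α) (fun x => ENNReal.ofReal (f x)) =
      ENNReal.ofReal ((∑ x, f x) / Fintype.card α) := by
  rw [expect_uniformOfFintype, ← ENNReal.ofReal_sum_of_nonneg fun x _ => hf x,
    ENNReal.ofReal_div_of_pos (by exact_mod_cast Fintype.card_pos), ENNReal.ofReal_natCast,
    ENNReal.div_eq_inv_mul]

/-- The coins of the rounds `τ`, regarded as one word (a set of rounds) for each child. -/
def hitTimesEquiv [Fintype ι] [DecidableEq τ] : (τ → Finset ι) ≃ (ι → Finset τ) where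
  toFun := hitTimes
  invFun := hitTimes
  left_inv c := by ext; simp [hitTimes]
  right_inv f := by ext; simp [hitTimes]

theorem dens_forall_mem [Fintype ι] [Fintype α] [Nonempty α] [DecidableEq α] (J : Finset ι)
    (S : Finset α) :
    ({f : ι → α | ∀ i ∈ J, f i ∈ S} : Finset (ι → α)).dens = S.dens ^ #J := by
  have h : ({f : ι → α | ∀ i ∈ J, f i ∈ S} : Finset (ι → α)) =
      Fintype.piFinset fun i => if i ∈ J then S else Finset.univ := by
    ext f
    simp only [Finset.mem_filter, Finset.mem_univ, true_and, Fintype.mem_piFinset]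
    refine forall_congr' fun i => ?_
    split_ifs with hi <;> simp [hi]
  rw [h, Finset.dens_eq_card_div_card, Fintype.card_piFinset, Fintype.card_pi, Nat.cast_prod,
    Nat.cast_prod, ← Finset.prod_div_distrib]
  simp only [apply_ite Finset.card, apply_ite (Nat.cast : ℕ → ℚ≥0), ite_div,
    ← Finset.dens_eq_card_div_card, Finset.card_univ, ne_eq, Nat.cast_eq_zero, Fintype.card_ne_zero,
    not_false_eq_true, div_self, Finset.prod_ite_mem, Finset.univ_inter, Finset.prod_const]

theorem cast_dens_compl [Fintype α] [Nonempty α] [DecidableEq α] (S : Finset α) :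
    (Sᶜ.dens : ℝ) = 1 - S.dens := by
  rw [eq_sub_iff_add_eq, ← NNRat.cast_add, ← Finset.dens_union_of_disjoint disjoint_compl_left,
    Finset.union_comm, Finset.union_compl, Finset.dens_univ, NNRat.cast_one]

theorem two_mul_sum_card_apply [DecidableEq τ] {E : Finset (ι → Finset τ)} {i : ι}
    (hE : ∀ f ∈ E, Function.update f i (f i)ᶜ ∈ E) :
    2 * ∑ f ∈ E, #(f i) = #E * Fintype.card τ := by
  have hflip : ∑ f ∈ E, #(f i) = ∑ f ∈ E, #(f i)ᶜ :=
    Finset.sum_nbij' (fun f => Function.update f i (f i)ᶜ) (fun f => Function.update f i (f i)ᶜ)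
      hE hE (by simp) (by simp) (by simp)
  rw [two_mul]
  nth_rw 2 [hflip]
  rw [← Finset.sum_add_distrib, Finset.sum_congr rfl fun f _ => Finset.card_add_card_compl (f i),
    Finset.sum_const, smul_eq_mul]

theorem sum_ite_card_apply [Fintype ι] [DecidableEq τ] {E : Finset (ι → Finset τ)} {i : ι}
    (hE : ∀ f ∈ E, Function.update f i (f i)ᶜ ∈ E) (x y : ℝ) :
    (∑ f, if f ∈ E then #(f i) * x else y) / Fintype.card (ι → Finset τ) =
      E.dens * (Fintype.card τ / 2 * x) + (1 - E.dens) * y := by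
  have hcard : (Fintype.card (ι → Finset τ) : ℝ) ≠ 0 := by exact_mod_cast Fintype.card_ne_zero
  have hhalf : 2 * ∑ f ∈ E, (#(f i) : ℝ) = #E * Fintype.card τ := by
    exact_mod_cast two_mul_sum_card_apply hE
  have hsplit : (∑ f, if f ∈ E then #(f i) * x else y) =
      (∑ f ∈ E, (#(f i) : ℝ)) * x + (Fintype.card (ι → Finset τ) - #E) * y := by
    rw [Finset.sum_ite, Finset.sum_const, nsmul_eq_mul, Finset.filter_univ_mem, Finset.sum_mul,
      ← Finset.compl_filter, Finset.filter_univ_mem, Finset.card_compl,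
      Nat.cast_sub (Finset.card_le_univ E)]
  rw [hsplit, Finset.nnratCast_dens]
  field_simp
  linear_combination x * hhalf

/-- Stay in the default child `i₀`, except in phases where a child in `J` receives a word in `G`. -/
theorem exists_side [Fintype ι] [DecidableEq τ] (J : Finset ι) (G : Finset (Finset τ)) {i₀ : ι}
    (hi₀ : i₀ ∉ J) {o : ι → ℝ} (ho : 0 ≤ o i₀) {D B : ℝ} (hD : 0 ≤ D) (hB : 0 ≤ B)
    (hG : ∀ w ∈ G, ∀ i ∈ J, #w * o i ≤ B) :
    ∃ side : (τ → Finset ι) → ι,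
      expect (PMF.uniformOfFintype (τ → Finset ι)) (fun c =>
        2 * (if side c = i₀ then 0 else ENNReal.ofReal D) +
          #(hitTimes c (side c)) * ENNReal.ofReal (o (side c))) ≤
      ENNReal.ofReal ((1 - G.dens) ^ #J * (Fintype.card τ / 2 * o i₀) +
        (1 - (1 - G.dens) ^ #J) * (2 * D + B)) := by
  set E : Finset (ι → Finset τ) := {f | ∀ i ∈ J, f i ∈ Gᶜ} with hE
  have hmem (f) : f ∈ E ↔ ∀ i ∈ J, f i ∉ G := by simp [hE]
  have hdens : (E.dens : ℝ) = (1 - G.dens) ^ #J := by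
    rw [hE, dens_forall_mem, NNRat.cast_pow, cast_dens_compl]
  have hside (f : ι → Finset τ) : ∃ i, (f ∈ E → i = i₀) ∧ (f ∉ E → i ∈ J ∧ f i ∈ G) := by
    by_cases hf : f ∈ E
    · exact ⟨i₀, by simp [hf]⟩
    · have hgood := hf
      simp only [hmem, not_forall, not_not] at hgood
      obtain ⟨i, hi, hfi⟩ := hgood
      exact ⟨i, by simp [hf, hi, hfi]⟩
  choose side hfail hhit using hside
  have hcost (f : ι → Finset τ) :
      2 * (if side f = i₀ then 0 else ENNReal.ofReal D) +
        #(f (side f)) * ENNReal.ofReal (o (side f)) ≤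
          ENNReal.ofReal (if f ∈ E then #(f i₀) * o i₀ else 2 * D + B) := by
    by_cases hf : f ∈ E
    · simp [hf, hfail f hf, ENNReal.ofReal_mul]
    · have hside_ne : side f ≠ i₀ := fun h => hi₀ (h ▸ (hhit f hf).1)
      rw [if_neg hf, if_neg hside_ne, ENNReal.ofReal_add (by positivity) hB,
        ENNReal.ofReal_mul zero_le_two, ENNReal.ofReal_ofNat, ← ENNReal.ofReal_natCast,
        ← ENNReal.ofReal_mul (Nat.cast_nonneg _)]
      gcongr
      exact hG _ (hhit f hf).2 _ (hhit f hf).1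
  refine ⟨fun c => side (hitTimes c), ?_⟩
  calc _ = expect (PMF.uniformOfFintype (ι → Finset τ)) _ :=
        expect_uniformOfFintype_comp_equiv hitTimesEquiv fun f =>
          2 * (if side f = i₀ then 0 else ENNReal.ofReal D) +
            #(f (side f)) * ENNReal.ofReal (o (side f))
    _ ≤ _ := expect_mono _ hcost
    _ = _ := by
      rw [expect_uniformOfFintype_ofReal fun f => by split_ifs <;> positivity, sum_ite_card_apply,
        hdens]
      intro f hf
      rw [hmem] at hf ⊢
      intro i hi
      rw [Function.update_of_ne (ne_of_mem_of_not_mem hi hi₀)]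
      exact hf i hi

end Words

section LightWords

variable {β κ τ : Type*}

theorem sum_powerset_insert_two_mul_card_sub [DecidableEq τ] {a : τ} {s : Finset τ} (ha : a ∉ s)
    (f : ℝ → ℝ) :
    ∑ w ∈ (insert a s).powerset, f (2 * #w - #(insert a s)) =
      ∑ w ∈ s.powerset, (f (2 * #w - #s - 1) + f (2 * #w - #s + 1)) := by
  rw [Finset.sum_powerset_insert ha, Finset.sum_add_distrib, Finset.card_insert_of_notMem ha]
  congr 1 <;> refine Finset.sum_congr rfl fun w hw => ?_
  · push_cast
    ring_nf
  · rw [Finset.card_insert_of_notMem fun h => ha (Finset.mem_powerset.1 hw h)]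
    push_cast
    ring_nf

theorem sum_powerset_two_mul_card_sub_sq (s : Finset τ) :
    ∑ w ∈ s.powerset, (2 * #w - #s : ℝ) ^ 2 = #s * 2 ^ #s := by
  classical
  induction s using Finset.induction_on with
  | empty => simp
  | insert a s ha ih =>
    rw [sum_powerset_insert_two_mul_card_sub ha (· ^ 2)]
    calc _ = ∑ w ∈ s.powerset, (2 * (2 * #w - #s : ℝ) ^ 2 + 2) :=
          Finset.sum_congr rfl fun w _ => by ring
      _ = _ := by
        rw [Finset.sum_add_distrib, ← Finset.mul_sum, ih, Finset.sum_const, Finset.card_powerset,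
          Finset.card_insert_of_notMem ha]
        simp only [nsmul_eq_mul, Nat.cast_pow, Nat.cast_add, Nat.cast_ofNat, Nat.cast_one]
        ring

theorem sum_powerset_two_mul_card_sub_pow_four (s : Finset τ) :
    ∑ w ∈ s.powerset, (2 * #w - #s : ℝ) ^ 4 = (3 * #s ^ 2 - 2 * #s) * 2 ^ #s := by
  classical
  induction s using Finset.induction_on with
  | empty => simp
  | insert a s ha ih =>
    rw [sum_powerset_insert_two_mul_card_sub ha (· ^ 4)]
    calc _ = ∑ w ∈ s.powerset, (2 * (2 * #w - #s : ℝ) ^ 4 + 12 * (2 * #w - #s : ℝ) ^ 2 + 2) :=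
          Finset.sum_congr rfl fun w _ => by ring
      _ = _ := by
        rw [Finset.sum_add_distrib, Finset.sum_add_distrib, ← Finset.mul_sum, ← Finset.mul_sum, ih,
          sum_powerset_two_mul_card_sub_sq, Finset.sum_const, Finset.card_powerset,
          Finset.card_insert_of_notMem ha]
        simp only [nsmul_eq_mul, Nat.cast_pow, Nat.cast_add, Nat.cast_ofNat, Nat.cast_one]
        ring

/-- The second moment method for the square of the centred size of a random subset. -/
theorem one_fifth_mul_le_sum_powerset {s : Finset τ} (hs : s.Nonempty) :
    1 / 5 * 2 ^ #s ≤ ∑ w ∈ s.powerset,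
      (1 - (1 - (4 * (2 * #w - #s) ^ 2 - #s) / (16 * #s)) ^ 2 : ℝ) := by
  have : (0 : ℝ) < #s := by exact_mod_cast hs.card_pos
  have hexpand (w : Finset τ) :
      (1 - (1 - (4 * (2 * #w - #s) ^ 2 - #s) / (16 * #s)) ^ 2 : ℝ) =
        17 / (32 * #s) * (2 * #w - #s) ^ 2 - 1 / (16 * #s ^ 2) * (2 * #w - #s) ^ 4 - 33 / 256 := by
    field_simp
    ring
  calc (1 / 5 * 2 ^ #s : ℝ) ≤ (55 / 256 + 1 / (8 * #s)) * 2 ^ #s := by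
        gcongr
        have : (0 : ℝ) < 1 / (8 * #s) := by positivity
        linarith
    _ = _ := by
      simp only [hexpand]
      rw [Finset.sum_sub_distrib, Finset.sum_sub_distrib, ← Finset.mul_sum, ← Finset.mul_sum,
        sum_powerset_two_mul_card_sub_sq, sum_powerset_two_mul_card_sub_pow_four, Finset.sum_const,
        Finset.card_powerset]
      simp only [nsmul_eq_mul, Nat.cast_pow, Nat.cast_ofNat]
      field_simp
      ring

theorem one_sub_one_sub_sq_nonpos {n x : ℝ} (hn : 0 < n) (hx : |x| ≤ √n / 2) :
    1 - (1 - (4 * x ^ 2 - n) / (16 * n)) ^ 2 ≤ 0 := by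
  have hdev : 4 * x ^ 2 ≤ n := by
    calc 4 * x ^ 2 ≤ 4 * (√n / 2) ^ 2 := by
          gcongr 4 * ?_
          exact sq_le_sq' (abs_le.1 hx).1 (abs_le.1 hx).2
      _ = n := by rw [div_pow, Real.sq_sqrt hn.le]; ring
  have hneg : (4 * x ^ 2 - n) / (16 * n) ≤ 0 :=
    div_nonpos_of_nonpos_of_nonneg (by linarith) (by positivity)
  nlinarith

theorem one_tenth_le_dens_card_le [Fintype τ] [Nonempty τ] :
    (1 / 10 : ℝ) ≤ ({w | #w ≤ (Fintype.card τ / 2 - √(Fintype.card τ) / 4 : ℝ)} :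
      Finset (Finset τ)).dens := by
  classical
  set n := Fintype.card τ
  have hn0 : (0 : ℝ) < n := by exact_mod_cast Fintype.card_pos
  set E : Finset (Finset τ) := {w | #w ≤ (n / 2 - √n / 4 : ℝ)} with hE
  have hcompl (w : Finset τ) : (#wᶜ : ℝ) = n - #w := by
    rw [Finset.card_compl, Nat.cast_sub (Finset.card_le_univ w)]
  have hpointwise (w : Finset τ) : (1 - (1 - (4 * (2 * #w - n) ^ 2 - n) / (16 * n)) ^ 2 : ℝ) ≤
      (if w ∈ E then 1 else 0) + if wᶜ ∈ E then 1 else 0 := by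
    by_cases hw : w ∈ E ∨ wᶜ ∈ E
    · have hone : (1 : ℝ) ≤ (if w ∈ E then 1 else 0) + if wᶜ ∈ E then 1 else 0 := by
        rcases hw with hw | hw <;> rw [if_pos hw] <;> split_ifs <;> norm_num
      exact (sub_le_self _ (sq_nonneg _)).trans hone
    · rw [not_or] at hw
      simp only [hE, Finset.mem_filter_univ, hcompl, not_le] at hw
      refine (one_sub_one_sub_sq_nonpos hn0 (abs_le.2 ⟨?_, ?_⟩)).trans (by positivity) <;> linarith
  have hflip : ∑ w : Finset τ, (if wᶜ ∈ E then 1 else 0 : ℝ) = ∑ w, if w ∈ E then 1 else 0 :=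
    Fintype.sum_bijective _ compl_bijective _ _ fun _ => rfl
  have hsum : 1 / 5 * 2 ^ n ≤ (2 * #E : ℝ) := by
    calc (1 / 5 * 2 ^ n : ℝ) ≤ _ := one_fifth_mul_le_sum_powerset Finset.univ_nonempty
      _ ≤ ∑ w : Finset τ, ((if w ∈ E then 1 else 0) + if wᶜ ∈ E then 1 else 0) := by
        rw [Finset.powerset_univ]
        exact Finset.sum_le_sum fun w _ => hpointwise w
      _ = 2 * #E := by
        rw [Finset.sum_add_distrib, hflip, ← two_mul, Finset.sum_boole, Finset.filter_univ_mem]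
  rw [Finset.nnratCast_dens, Fintype.card_finset, le_div_iff₀ (by positivity)]
  push_cast
  linarith

/-- The words on `τ`, cut along `e` into blocks `β` indexed by `κ`. -/
def blocksEquiv [Fintype β] [Fintype τ] [DecidableEq β] [DecidableEq τ] (e : τ ≃ κ × β) :
    Finset τ ≃ (κ → Finset β) where
  toFun w i := {b | e.symm (i, b) ∈ w}
  invFun f := {t | (e t).2 ∈ f (e t).1}
  left_inv w := by ext; simp
  right_inv f := by ext; simp

theorem card_eq_sum_card_blocksEquiv [Fintype β] [Fintype κ] [Fintype τ] [DecidableEq β]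
    [DecidableEq τ] (e : τ ≃ κ × β) (w : Finset τ) : #w = ∑ i, #(blocksEquiv e w i) := by
  simp only [blocksEquiv, Equiv.coe_fn_mk, Finset.card_filter, ← Fintype.sum_prod_type',
    e.symm.sum_comp fun t => if t ∈ w then 1 else 0]
  simp

theorem exists_light_words [Fintype β] [Nonempty β] [Fintype κ] [Fintype τ] (e : τ ≃ κ × β) :
    ∃ G : Finset (Finset τ), (1 / 10 : ℝ) ^ Fintype.card κ ≤ G.dens ∧
      ∀ w ∈ G, #w ≤ (Fintype.card κ * (Fintype.card β / 2 - √(Fintype.card β) / 4) : ℝ) := by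
  classical
  set S : Finset (Finset β) := {w | #w ≤ (Fintype.card β / 2 - √(Fintype.card β) / 4 : ℝ)} with hS
  refine ⟨({f | ∀ i ∈ Finset.univ, f i ∈ S} : Finset (κ → _)).map (blocksEquiv e).symm.toEmbedding,
    ?_, fun w hw => ?_⟩
  · rw [Finset.dens_map_equiv, dens_forall_mem, NNRat.cast_pow, Finset.card_univ]
    gcongr
    exact one_tenth_le_dens_card_le
  · rw [Finset.mem_map_equiv, Equiv.symm_symm, Finset.mem_filter_univ] at hw
    rw [card_eq_sum_card_blocksEquiv e, Nat.cast_sum, ← nsmul_eq_mul]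
    refine Finset.sum_le_card_nsmul _ _ _ fun i hi => ?_
    simpa [hS] using hw i hi

end LightWords

section Gain

/-- The expected offline cost of a phase of `n` rounds of a star, in units of the online cost of an
attack. With probability `(1 - η) ^ N` none of the `N` candidate children receives a good word, and
the phase is played in a child whose online-to-offline ratio is `r`; otherwise the offline player
moves to and from a candidate, whose attacks cost at most `B`. -/
noncomputable def phaseRate (n N : ℕ) (η r B : ℝ) : ℝ :=
  (1 - η) ^ N * (n / (2 * r)) + (1 - (1 - η) ^ N) * (96 + B)

/-- A star whose default child has ratio `r`, and `N` other children of which have ratio at least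
`s`, attains the ratio `r'`: there are a phase length `n` and a set `G` of good words for which the
offline player pays at most the fraction `1 / r'` of the online cost `n / 2` of a phase. -/
def Improves (r s : ℝ) (N : ℕ) (r' : ℝ) : Prop :=
  ∃ n : ℕ, 0 < n ∧ ∃ G : Finset (Finset (Fin n)), ∃ B : ℝ, 0 ≤ B ∧ (∀ w ∈ G, #w ≤ B * s) ∧
    phaseRate n N G.dens r B ≤ n / (2 * r')

theorem Improves.mono {r s s' r' : ℝ} {N : ℕ} (h : Improves r s N r') (hs : s ≤ s') :
    Improves r s' N r' := by
  obtain ⟨n, hn, G, B, hB, hG, hrate⟩ := h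
  exact ⟨n, hn, G, B, hB, fun w hw => (hG w hw).trans (by gcongr), hrate⟩

theorem one_sub_pow_le {x η : ℝ} (hx : 0 ≤ x) (hxη : x ≤ η) (hη : η ≤ 1) (N : ℕ) :
    (1 - η) ^ N ≤ 1 / (1 + N * x) := by
  have hexp : (1 - η) ^ N ≤ Real.exp (-(N * x)) := by
    calc (1 - η) ^ N ≤ Real.exp (-x) ^ N := by
          gcongr
          exact (sub_le_sub_left hxη 1).trans (Real.one_sub_le_exp_neg x)
      _ = Real.exp (-(N * x)) := by rw [← Real.exp_nat_mul, mul_neg]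
  rw [Real.exp_neg, ← one_div] at hexp
  refine hexp.trans (one_div_le_one_div_of_le (by positivity) ?_)
  linarith [Real.add_one_le_exp (N * x)]

theorem min_half_le_one_sub_pow {x η : ℝ} (hx : 0 ≤ x) (hxη : x ≤ η) (hη : η ≤ 1) (N : ℕ) :
    min (1 / 2) (N * x / 2) ≤ 1 - (1 - η) ^ N := by
  have hpow := one_sub_pow_le hx hxη hη N
  rcases le_total (N * x) 1 with h | h
  · have : 1 / (1 + N * x) ≤ 1 - N * x / 2 := by
      rw [div_le_iff₀ (by positivity)]
      nlinarith [mul_nonneg N.cast_nonneg hx]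
    exact (min_le_right _ _).trans (by linarith)
  · have : 1 / (1 + N * x) ≤ 1 / 2 := one_div_le_one_div_of_le (by norm_num) (by linarith)
    exact (min_le_left _ _).trans (by linarith)

theorem improves_of_le_mul {r s g B : ℝ} {n N : ℕ} (hn : 0 < n) (hr : 0 < r) (hg : 0 ≤ g)
    (hB : 0 ≤ B) {G : Finset (Finset (Fin n))} (hG : ∀ w ∈ G, #w ≤ B * s)
    (hgain : g ≤ (1 - (1 - G.dens) ^ N) * (r - 2 * r ^ 2 * (96 + B) / n)) :
    Improves r s N (r + g) := by
  refine ⟨n, hn, G, B, hB, hG, ?_⟩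
  have : (0 : ℝ) < n := by exact_mod_cast hn
  rw [phaseRate]
  set p : ℝ := 1 - (1 - G.dens) ^ N with hp
  have hgain' : n * g ≤ r * (p * (n - 2 * r * (96 + B))) := by
    calc n * g ≤ n * (p * (r - 2 * r ^ 2 * (96 + B) / n)) := by gcongr
      _ = _ := by field_simp
  have hsaving : 0 ≤ p * (n - 2 * r * (96 + B)) :=
    nonneg_of_mul_nonneg_right (le_trans (by positivity) hgain') hr
  rw [le_div_iff₀ (by positivity), show (1 - (G.dens : ℝ)) ^ N = 1 - p by rw [hp]; ring]
  have hcost : ((1 - p) * (n / (2 * r)) + p * (96 + B)) * (2 * (r + g)) =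
      n + (n * g - p * (n - 2 * r * (96 + B)) * (r + g)) / r := by
    field_simp
    ring
  rw [hcost, add_le_iff_nonpos_right]
  exact div_nonpos_of_nonpos_of_nonneg (by linarith [mul_nonneg hsaving hg]) hr.le

theorem exists_nat_mul_le_of_le {x r : ℝ} (hx : 0 < x) (hxr : x ≤ r) :
    ∃ l : ℕ, 0 < l ∧ l * x ≤ r ∧ r ≤ l * (2 * x) := by
  have hl : 0 < ⌊r / x⌋₊ := Nat.floor_pos.2 ((one_le_div₀ hx).2 hxr)
  refine ⟨⌊r / x⌋₊, hl, (le_div_iff₀ hx).1 (Nat.floor_le (div_nonneg (hx.le.trans hxr) hx.le)), ?_⟩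
  have hlt : r < (⌊r / x⌋₊ + 1) * x := (div_lt_iff₀ hx).1 (Nat.lt_floor_add_one _)
  have hl' : (1 : ℝ) ≤ ⌊r / x⌋₊ := by exact_mod_cast hl
  nlinarith

/-- In phases of order `r ^ 2 / L` rounds the gain comes from moderate deviations: with probability
`exp (-O(L))` a child is attacked about `r` times less often than on average. -/
theorem improves_of_light {r g : ℝ} {L N : ℕ} (hL : 1 ≤ L) (hLr : 4 * (L : ℝ) ≤ r) (hg : 0 ≤ g)
    (hgain : g ≤ min (1 / 2) (N * (1 / 10 : ℝ) ^ (9216 * L) / 2) * (L / 6)) :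
    Improves r (r - L) N (r + g) := by
  have hL' : (1 : ℝ) ≤ L := by exact_mod_cast hL
  have hr : 0 < r := by linarith
  obtain ⟨l, hl, hup, hlow⟩ := exists_nat_mul_le_of_le (x := 4 * (L : ℝ)) (by positivity) hLr
  have : (1 : ℝ) ≤ l := by exact_mod_cast hl
  have : NeZero (l ^ 2) := ⟨by positivity⟩
  obtain ⟨G, hdens, hlight⟩ :=
    exists_light_words (finProdFinEquiv (m := 9216 * L) (n := l ^ 2)).symm
  simp only [Fintype.card_fin, Nat.cast_pow, Nat.cast_mul, Nat.cast_ofNat,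
    Real.sqrt_sq (Nat.cast_nonneg l)] at hdens hlight
  have hn : 288 * r ≤ 9216 * L * l ^ 2 := by nlinarith
  have hsmall : 9216 * L * l ^ 2 * L ≤ 576 * r ^ 2 := by
    linarith [pow_le_pow_left₀ (by positivity) hup 2]
  have hB : 144 ≤ 9216 * L * l ^ 2 / (2 * r) := by
    rw [le_div_iff₀ (by positivity)]
    linarith
  refine improves_of_le_mul (n := 9216 * L * l ^ 2) (B := 9216 * L * l ^ 2 / (2 * r) - 144)
    (by positivity) hr hg (by linarith) (G := G) (fun w hw => (hlight w hw).trans ?_)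
    (hgain.trans ?_)
  · have hmean : (9216 * L * l ^ 2 / (2 * r) - 144) * (r - L) =
        9216 * L * (l ^ 2 / 2) - 9216 * L * l * (l * L) / (2 * r) - 144 * r + 144 * L := by
      field_simp
      ring
    have hshift : 9216 * L * l * (l * L) / (2 * r) ≤ 9216 * L * l / 8 := by
      rw [div_le_iff₀ (by positivity)]
      nlinarith [mul_le_mul_of_nonneg_left hup (show (0 : ℝ) ≤ 9216 * L * l by positivity)]
    linarith
  · have hfactor : r - 2 * r ^ 2 * (96 + (9216 * L * l ^ 2 / (2 * r) - 144)) /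
        (9216 * L * l ^ 2) = 96 * r ^ 2 / (9216 * L * l ^ 2) := by
      field_simp
      ring
    simp only [Nat.cast_mul, Nat.cast_pow, Nat.cast_ofNat]
    rw [hfactor]
    have hhit := min_half_le_one_sub_pow (by positivity) hdens (by exact_mod_cast G.dens_le_one) N
    refine mul_le_mul hhit ?_ (by positivity) (le_trans (by positivity) hhit)
    rw [div_le_div_iff₀ (by norm_num) (by positivity)]
    linarith

theorem dens_singleton_finset {τ : Type*} [Fintype τ] (w : Finset τ) :
    (({w} : Finset (Finset τ)).dens : ℝ) = (1 / 2) ^ Fintype.card τ := by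
  simp [NNRat.cast_inv]

/-- In shorter phases the gain comes from a child that is never attacked. -/
theorem improves_of_empty_word {n N : ℕ} {r s g : ℝ} (hr : 0 < r) (hg : 0 ≤ g) (hn : 384 * r ≤ n)
    (hgain : g ≤ min (1 / 2) (N * (1 / 2 : ℝ) ^ n / 2) * (r / 2)) : Improves r s N (r + g) := by
  have hn' : (0 : ℝ) < n := by linarith
  refine improves_of_le_mul (G := {∅}) (by exact_mod_cast hn') hr hg le_rfl (by simp)
    (hgain.trans ?_)
  rw [dens_singleton_finset, Fintype.card_fin]
  have hhit := min_half_le_one_sub_pow (x := (1 / 2 : ℝ) ^ n) (by positivity) le_rfl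
    (pow_le_one₀ (by norm_num) (by norm_num)) N
  have hloss : 2 * r ^ 2 * (96 + 0) / n ≤ r / 2 := by
    rw [div_le_iff₀ hn']
    nlinarith
  exact mul_le_mul hhit (by linarith) (by positivity) (le_trans (by positivity) hhit)

theorem improves_of_empty_word_of_le {n N : ℕ} {r s r' : ℝ} (hr : 1 ≤ r) (hr' : 0 < r')
    (hn : n ≤ 192 * (1 + N * (1 / 2 : ℝ) ^ n)) (hrn : 384 * r' ≤ n) : Improves r s N r' := by
  have hn' : (0 : ℝ) < n := by linarith
  refine ⟨n, by exact_mod_cast hn', {∅}, 0, le_rfl, by simp, ?_⟩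
  rw [dens_singleton_finset, Fintype.card_fin, phaseRate]
  have hhalf : (1 / 2 : ℝ) ^ n ≤ 1 := pow_le_one₀ (by norm_num) (by norm_num)
  set q : ℝ := (1 - (1 / 2) ^ n) ^ N
  have hq : 0 ≤ q := pow_nonneg (by linarith) N
  have hqn : q * n ≤ 192 := by
    calc q * n ≤ 1 / (1 + N * (1 / 2 : ℝ) ^ n) * (192 * (1 + N * (1 / 2 : ℝ) ^ n)) := by
          gcongr
          exact one_sub_pow_le (by positivity) le_rfl hhalf N
      _ = 192 := by field_simp
  have hmiss : q * (n / (2 * r)) ≤ 96 := by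
    rw [← mul_div_assoc, div_le_iff₀ (by positivity)]
    linarith
  have hrate : 192 ≤ n / (2 * r') := by
    rw [le_div_iff₀ (by positivity)]
    linarith
  linarith

theorem sqrt_mul_exp_neg_le {K C j x : ℝ} (hK : 0 ≤ K) (hC : 0 < C) (hKC : 2 * K ≤ C) (hj : 1 ≤ j)
    (hx : x ≤ Real.log j / C + 1) : √j * Real.exp (-K) ≤ j * Real.exp (-(K * x)) := by
  have hhalf : K * (Real.log j / C) ≤ Real.log j / 2 := by
    rw [mul_div_assoc', div_le_div_iff₀ hC two_pos]
    nlinarith [Real.log_nonneg hj]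
  have hmul : K * x ≤ K * (Real.log j / C + 1) := by gcongr
  have hexp : Real.exp (Real.log j) = j := Real.exp_log (by linarith)
  rw [← Real.exp_log (by positivity : 0 < √j), Real.log_sqrt (by linarith), ← Real.exp_add]
  nth_rw 2 [← hexp]
  rw [← Real.exp_add, Real.exp_le_exp]
  linarith

theorem log_le_two_mul_sqrt {j : ℝ} (hj : 0 < j) : Real.log j ≤ 2 * √j := by
  have hlog := Real.log_le_sub_one_of_pos (Real.sqrt_pos.2 hj)
  rw [Real.log_sqrt hj.le] at hlog
  linarith

theorem exp_sq_mul_min_log_le {K C δ L : ℝ} (hK : 0 ≤ K) (hKC : K ≤ C) (hδ : 0 ≤ δ)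
    (hL : L ≤ δ + 2) (N : ℕ) :
    Real.exp (-K) ^ 2 * min (Real.log (N + 1)) ((N + 1) * Real.exp (-(C * δ))) ≤
      2 * (N * Real.exp (-(K * L))) := by
  have hmin : min (Real.log (N + 1)) ((N + 1) * Real.exp (-(C * δ))) ≤
      2 * N * Real.exp (-(K * δ)) := by
    rcases N.eq_zero_or_pos with rfl | hN
    · simp
    · have : (1 : ℝ) ≤ N := by exact_mod_cast hN
      refine (min_le_right _ _).trans ?_
      gcongr
      linarith
  calc _ ≤ Real.exp (-K) ^ 2 * (2 * N * Real.exp (-(K * δ))) := by gcongr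
    _ = 2 * (N * (Real.exp (-K) ^ 2 * Real.exp (-(K * δ)))) := by ring
    _ ≤ 2 * (N * Real.exp (-(K * L))) := by
      gcongr 2 * (N * ?_)
      rw [← Real.exp_nat_mul, ← Real.exp_add, Real.exp_le_exp]
      push_cast
      nlinarith

theorem exp_neg_mul_log_le {K C L : ℝ} {N : ℕ} (hK : 0 ≤ K) (hC : 0 < C) (hKC : 2 * K ≤ C)
    (hN : 0 < N) (hL : L ≤ Real.log (N + 1) / C + 1) :
    Real.exp (-K) * Real.log (N + 1) ≤ 4 * (N * Real.exp (-(K * L))) := by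
  have : (1 : ℝ) ≤ N := by exact_mod_cast hN
  calc _ ≤ Real.exp (-K) * (2 * √(N + 1)) := by
        gcongr
        exact log_le_two_mul_sqrt (by positivity)
    _ = 2 * (√(N + 1) * Real.exp (-K)) := by ring
    _ ≤ 2 * ((N + 1) * Real.exp (-(K * L))) := by
        gcongr 2 * ?_
        exact sqrt_mul_exp_neg_le hK hC hKC (by simp) hL
    _ ≤ 2 * ((N + N) * Real.exp (-(K * L))) := by gcongr
    _ = _ := by ring

/-- A level `L` such that a good word of probability `exp (-K * L)`, wanted by `N` children, yields
the gain `c * min …`: `L` is the larger of `1 + δ` and `log (N + 1) / C`, rounded up. -/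
theorem exists_deviation_level {K : ℝ} (hK : 0 < K) : ∃ c C : ℝ, 0 < c ∧ 0 < C ∧
    ∀ (δ : ℝ) (N : ℕ), 0 ≤ δ → ∃ L : ℕ, 1 + δ ≤ L ∧
      c * min (Real.log (N + 1)) ((N + 1) * Real.exp (-(C * δ))) ≤ L / 12 ∧
      c * min (Real.log (N + 1)) ((N + 1) * Real.exp (-(C * δ))) ≤ N * Real.exp (-(K * L)) / 12 ∧
      (c * min (Real.log (N + 1)) ((N + 1) * Real.exp (-(C * δ))) ≤ (1 + δ) / 12 ∨
        2048 * L ≤ 192 * (1 + N * Real.exp (-(K * L)))) := by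
  have hKexp : K < Real.exp K := by linarith [Real.add_one_le_exp K]
  refine ⟨Real.exp (-K) ^ 2 / 1536, 128 * Real.exp K, by positivity, by positivity,
    fun δ N hδ => ?_⟩
  set C := 128 * Real.exp K with hC
  have hC0 : 0 < C := by positivity
  set x := Real.log (N + 1) / C with hx
  have hlogx : Real.exp (-K) * Real.log (N + 1) = 128 * x := by
    rw [hx, hC, Real.exp_neg]
    field_simp
  have hx0 : 0 ≤ x := div_nonneg (Real.log_nonneg (by simp)) hC0.le
  have hmin := exp_sq_mul_min_log_le (L := ⌈1 + δ⌉₊) hK.le (by linarith : K ≤ C) hδ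
    (by linarith [Nat.ceil_lt_add_one (by linarith : 0 ≤ 1 + δ)]) N
  have hgain : Real.exp (-K) ^ 2 / 1536 * min (Real.log (N + 1)) ((N + 1) * Real.exp (-(C * δ))) ≤
      x / 12 := by
    calc _ ≤ Real.exp (-K) ^ 2 / 1536 * Real.log (N + 1) := by gcongr; exact min_le_left _ _
      _ = Real.exp (-K) * (x / 12) := by linear_combination Real.exp (-K) / 1536 * hlogx
      _ ≤ x / 12 := mul_le_of_le_one_left (by positivity) (Real.exp_le_one_iff.2 (by linarith))
  rcases le_or_gt x (1 + δ) with h | h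
  · have : 0 ≤ N * Real.exp (-(K * ⌈1 + δ⌉₊)) := by positivity
    exact ⟨⌈1 + δ⌉₊, Nat.le_ceil _, by linarith [Nat.le_ceil (1 + δ)], by linarith,
      Or.inl (by linarith)⟩
  · have hN : 0 < N := Nat.pos_of_ne_zero fun h0 => by simp [hx, h0] at h; linarith
    have hlog := exp_neg_mul_log_le hK.le hC0 (by linarith) hN
      (Nat.ceil_lt_add_one hx0).le
    have hceil := Nat.ceil_lt_add_one hx0
    exact ⟨⌈x⌉₊, by linarith [Nat.le_ceil x], by linarith [Nat.le_ceil x], by linarith,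
      Or.inr (by linarith)⟩

theorem exists_improves : ∃ c C : ℝ, 0 < c ∧ 0 < C ∧ ∀ (r s : ℝ) (N : ℕ), 1 ≤ s → s ≤ r →
    Improves r s N (r + c * min (Real.log (N + 1)) ((N + 1) * Real.exp (-(C * (r - s))))) := by
  obtain ⟨c, C, hc, hC, hlevel⟩ :=
    exists_deviation_level (K := 9216 * Real.log 10) (by positivity)
  refine ⟨c, C, hc, hC, fun r s N hs hsr => ?_⟩
  obtain ⟨L, hL, hgL, hgN, hgain⟩ := hlevel (r - s) N (sub_nonneg.2 hsr)
  have hg : 0 ≤ c * min (Real.log (N + 1)) ((N + 1) * Real.exp (-(C * (r - s)))) :=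
    mul_nonneg hc.le (le_min (Real.log_nonneg (by simp)) (by positivity))
  set g := c * min (Real.log (N + 1)) ((N + 1) * Real.exp (-(C * (r - s))))
  have hL1 : (1 : ℝ) ≤ L := by linarith
  have hten : (1 / 10 : ℝ) ^ (9216 * L) = Real.exp (-(9216 * Real.log 10 * L)) := by
    have hcast : 9216 * Real.log 10 * L = (9216 * L : ℕ) * Real.log 10 := by push_cast; ring
    rw [hcast, Real.exp_neg, Real.exp_nat_mul, Real.exp_log (by norm_num), one_div, inv_pow]
  rcases le_or_gt (4 * (L : ℝ)) r with hLr | hLr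
  · refine (improves_of_light (by exact_mod_cast hL1) hLr hg ?_).mono (by linarith)
    rw [hten, min_mul_of_nonneg _ _ (by positivity)]
    refine le_min (by linarith) ?_
    nlinarith [show 0 ≤ N * Real.exp (-(9216 * Real.log 10 * L)) by positivity]
  · have htwo : N * Real.exp (-(9216 * Real.log 10 * L)) ≤ N * (1 / 2 : ℝ) ^ (2048 * L) := by
      rw [← hten]
      gcongr N * ?_
      calc (1 / 10 : ℝ) ^ (9216 * L) ≤ (1 / 10) ^ (2048 * L) :=
            pow_le_pow_of_le_one (by norm_num) (by norm_num) (by lia)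
        _ ≤ _ := by gcongr; norm_num
    have hn : ((2048 * L : ℕ) : ℝ) = 2048 * L := by push_cast; rfl
    rcases hgain with hgain | hgain
    · refine improves_of_empty_word (n := 2048 * L) (by linarith) hg (by rw [hn]; linarith) ?_
      rw [min_mul_of_nonneg _ _ (by linarith)]
      refine le_min (by linarith) ?_
      nlinarith
    · exact improves_of_empty_word_of_le (n := 2048 * L) (by linarith) (by linarith)
        (by rw [hn]; linarith) (by rw [hn]; linarith)

end Gain

section Ratio

theorem injective_card_le {ι κ : Type*} [Fintype ι] [LinearOrder κ] {f : ι → κ}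
    (hf : f.Injective) : Function.Injective fun i => #{j | f i ≤ f j} := by
  have hlt {i j : ι} (h : f i < f j) : #{k | f j ≤ f k} < #{k | f i ≤ f k} := by
    refine Finset.card_lt_card ⟨fun k hk => ?_, fun hsub => ?_⟩
    · rw [Finset.mem_filter_univ] at hk ⊢
      exact h.le.trans hk
    · exact h.not_ge ((Finset.mem_filter_univ i).1 (hsub ((Finset.mem_filter_univ i).2 le_rfl)))
  intro i j hij
  by_contra hne
  rcases (hf.ne hne).lt_or_gt with h | h
  · exact (hlt h).ne' hij
  · exact (hlt h).ne hij

theorem exists_rank {ι : Type*} [Fintype ι] (r : ι → ℝ) :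
    ∃ ρ : ι → ℕ, ρ.Injective ∧ ∀ i, 0 < ρ i ∧ ρ i ≤ #{j | r i ≤ r j} := by
  let key (i : ι) : ℝ ×ₗ Fin (Fintype.card ι) := toLex (r i, Fintype.equivFin ι i)
  have hkey : key.Injective := fun i j h =>
    (Fintype.equivFin ι).injective (congrArg Prod.snd (toLex.injective h))
  refine ⟨fun i => #{j | key i ≤ key j}, injective_card_le hkey, fun i => ⟨?_, ?_⟩⟩
  · exact Finset.card_pos.2 ⟨i, by simp⟩
  · exact Finset.card_le_card
      (Finset.monotone_filter_right _ fun j _ h => Prod.Lex.monotone_fst _ _ h)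

theorem exp_neg_two_mul_le {k : ℕ} {C x δ : ℝ} (hk : Real.exp x < k)
    (h : min (Real.log k) (k * Real.exp (-(C * δ))) ≤ x) :
    Real.exp (-(2 * C * δ)) ≤ x ^ 2 * ((k : ℝ) ^ 2)⁻¹ := by
  have hk0 : (0 : ℝ) < k := (Real.exp_pos x).trans hk
  have hlog : x < Real.log k := (Real.lt_log_iff_exp_lt hk0).2 hk
  have hexp : Real.exp (-(C * δ)) ≤ x / k := by
    rw [le_div_iff₀ hk0, mul_comm]
    exact (min_le_iff.1 h).resolve_left hlog.not_ge
  calc Real.exp (-(2 * C * δ)) = Real.exp (-(C * δ)) ^ 2 := by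
        rw [← Real.exp_nat_mul]
        push_cast
        ring_nf
    _ ≤ (x / k) ^ 2 := by gcongr
    _ = _ := by rw [div_pow, div_eq_mul_inv]

theorem sum_exp_neg_le {ι : Type*} [Fintype ι] {ρ : ι → ℕ} (hρ : ρ.Injective)
    (hρ0 : ∀ i, 0 < ρ i) {C x : ℝ} (hC : 0 ≤ C) (hx : 0 ≤ x) {δ : ι → ℝ} (hδ : ∀ i, 0 ≤ δ i)
    (h : ∀ i, min (Real.log (ρ i)) (ρ i * Real.exp (-(C * δ i))) ≤ x) :
    ∑ i, Real.exp (-(2 * C * δ i)) ≤ Real.exp (2 * x) := by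
  have hfloor : 0 < ⌊Real.exp x⌋₊ := Nat.floor_pos.2 (Real.one_le_exp hx)
  set K := ⌊Real.exp x⌋₊
  set M := ∑ i, ρ i + K
  have hhead : ∑ i with ρ i ≤ K, Real.exp (-(2 * C * δ i)) ≤ Real.exp x := by
    have hcard : #{i | ρ i ≤ K} ≤ K := by
      simpa using Finset.card_le_card_of_injOn ρ (t := Finset.Ioc 0 K)
        (fun i hi => by simpa [hρ0 i] using hi) hρ.injOn
    calc _ ≤ ∑ i with ρ i ≤ K, (1 : ℝ) := Finset.sum_le_sum fun i _ =>
          Real.exp_le_one_iff.2 (by simpa using by positivity [hδ i])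
      _ ≤ K := by simpa using hcard
      _ ≤ Real.exp x := Nat.floor_le (by positivity)
  have htail : ∑ i with ¬ρ i ≤ K, Real.exp (-(2 * C * δ i)) ≤ x ^ 2 := by
    calc _ ≤ ∑ i with ¬ρ i ≤ K, x ^ 2 * ((ρ i : ℝ) ^ 2)⁻¹ := Finset.sum_le_sum fun i hi =>
          exp_neg_two_mul_le ((Nat.floor_lt (by positivity)).1 (by simpa using hi)) (h i)
      _ = x ^ 2 * ∑ k ∈ Finset.image ρ {i | ¬ρ i ≤ K}, ((k : ℝ) ^ 2)⁻¹ := by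
          rw [Finset.sum_image hρ.injOn, Finset.mul_sum]
      _ ≤ x ^ 2 * ∑ k ∈ Finset.Ioc K M, ((k : ℝ) ^ 2)⁻¹ := by
          gcongr
          refine Finset.image_subset_iff.2 fun i hi => Finset.mem_Ioc.2 ⟨by simpa using hi, ?_⟩
          exact (Finset.single_le_sum (fun _ _ => Nat.zero_le _) (Finset.mem_univ i)).trans
            (Nat.le_add_right _ _)
      _ ≤ x ^ 2 * 1 := by
          gcongr
          have : ((K : ℝ))⁻¹ ≤ 1 := inv_le_one_of_one_le₀ (by exact_mod_cast hfloor)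
          have : 0 ≤ ((M : ℝ))⁻¹ := by positivity
          linarith [sum_Ioc_inv_sq_le_sub (α := ℝ) hfloor.ne' (Nat.le_add_left K (∑ i, ρ i))]
      _ = x ^ 2 := mul_one _
  rw [← Finset.sum_filter_add_sum_filter_not Finset.univ (fun i => ρ i ≤ K)]
  have hexp : Real.exp (2 * x) = Real.exp x * Real.exp x := by rw [← Real.exp_add, two_mul]
  nlinarith [Real.add_one_le_exp x]

/-- The candidates are the children of ratio at least `r i`, for the child `i` that maximizes the
gain guaranteed by `exists_improves`; since no other child does better, the ratios of the children
decay quickly enough for the exponential sum to be dominated by that gain. -/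
theorem exists_improves_sum_exp_le : ∃ C : ℝ, 0 < C ∧ ∀ {ι : Type*} [Fintype ι] [Nonempty ι]
    (r : ι → ℝ), (∀ i, 1 ≤ r i) → ∃ (i₀ : ι) (J : Finset ι) (s r' : ℝ), i₀ ∉ J ∧
      (∀ j ∈ J, s ≤ r j) ∧ Improves (r i₀) s #J r' ∧ r i₀ ≤ r' ∧
      ∑ i, Real.exp (C * r i) ≤ Real.exp (C * r') := by
  classical
  obtain ⟨c, C, hc, hC, himp⟩ := exists_improves
  refine ⟨2 / c + 2 * C, by positivity, fun {ι} _ _ r hr => ?_⟩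
  obtain ⟨ρ, hρ, hrank⟩ := exists_rank r
  obtain ⟨i₀, hi₀⟩ := Finite.exists_max r
  let gain (i : ι) : ℝ := min (Real.log (ρ i)) (ρ i * Real.exp (-(C * (r i₀ - r i))))
  obtain ⟨i, hi⟩ := Finite.exists_max gain
  have hgain : 0 ≤ gain i := le_min (Real.log_natCast_nonneg _) (by positivity)
  obtain ⟨J, hJ, hcard⟩ : ∃ J ⊆ ({j | r i ≤ r j} : Finset ι).erase i₀, #J = ρ i - 1 := by
    refine Finset.exists_subset_card_eq ?_
    rw [Finset.card_erase_of_mem ((Finset.mem_filter_univ i₀).2 (hi₀ i))]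
    exact Nat.sub_le_sub_right (hrank i).2 1
  have hcast : ((#J : ℕ) : ℝ) + 1 = ρ i := by
    rw [hcard]
    exact_mod_cast Nat.sub_add_cancel (hrank i).1
  refine ⟨i₀, J, r i, r i₀ + c * gain i, fun h => Finset.notMem_erase _ _ (hJ h),
    fun j hj => by simpa using Finset.mem_of_mem_erase (hJ hj), ?_,
    le_add_of_nonneg_right (by positivity), ?_⟩
  · simpa only [hcast] using himp (r i₀) (r i) #J (hr i) (hi₀ i)
  · have hsum := sum_exp_neg_le hρ (fun i => (hrank i).1) hC.le hgain
      (fun j => sub_nonneg.2 (hi₀ j)) hi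
    calc ∑ j, Real.exp ((2 / c + 2 * C) * r j)
        ≤ ∑ j, Real.exp ((2 / c + 2 * C) * r i₀) * Real.exp (-(2 * C * (r i₀ - r j))) := by
          refine Finset.sum_le_sum fun j _ => ?_
          rw [← Real.exp_add, Real.exp_le_exp]
          linarith [mul_le_mul_of_nonneg_left (hi₀ j) (by positivity : 0 ≤ 2 / c)]
      _ ≤ Real.exp ((2 / c + 2 * C) * r i₀) * Real.exp (2 * gain i) := by
          rw [← Finset.mul_sum]
          gcongr
      _ ≤ Real.exp ((2 / c + 2 * C) * (r i₀ + c * gain i)) := by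
          rw [← Real.exp_add, Real.exp_le_exp]
          have : 2 / c * (c * gain i) = 2 * gain i := by field_simp
          linarith [show 0 ≤ C * (c * gain i) by positivity]

variable {V : Type*} [MetricSpace V]

/-- There is an adversary on `A` whose online-to-offline ratio is `r`, for a set `A` of diameter
about `D`. The constants leave room for one star at scale `D`: the exit fee `D / 16` is the distance
between different children, and moving to a child and back costs `2 * D`, which is `96` times the
online cost `D / 48` of an attack. -/
def HasRatio (A : Finset V) (D r : ℝ) : Prop :=
  ∃ p : PMF (FreeMonoid (Task V)), IsAdversary A p (ENNReal.ofReal (D / 48))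
    (ENNReal.ofReal (D / 16)) (ENNReal.ofReal (D / (48 * r)))

theorem hasRatio_singleton (v : V) {D : ℝ} (hD : 0 ≤ D) : HasRatio {v} D 1 :=
  ⟨_, (isAdversary_singleton v (ENNReal.ofReal (D / 48))).mono
    (ENNReal.ofReal_le_ofReal (by linarith)) (by rw [mul_one])⟩

/-- Repeating the adversary makes up for the scale. -/
theorem hasRatio_two_mul {A : Finset V} {p : PMF (FreeMonoid (Task V))} {D r : ℝ} (hD : 0 ≤ D)
    (hp : IsAdversary A p (ENNReal.ofReal (D / 48) / 2) (ENNReal.ofReal (D / 16))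
      (ENNReal.ofReal (D / (96 * r)))) : HasRatio A (2 * D) r := by
  have hfour (x : ℝ) : ((4 : ℕ) : ℝ≥0∞) * ENNReal.ofReal x = ENNReal.ofReal (4 * x) := by
    rw [← ENNReal.ofReal_natCast, ← ENNReal.ofReal_mul (by positivity), Nat.cast_ofNat]
  have hpow := hp.pow 4
  rw [← ENNReal.ofReal_ofNat 2, ← ENNReal.ofReal_div_of_pos two_pos, hfour, hfour] at hpow
  refine ⟨p ^ 4, ?_⟩
  convert hpow.mono (γ' := ENNReal.ofReal (2 * D / 16)) ?_ le_rfl using 2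
  · ring
  · rw [show (48 : ℝ) * r = 96 * r / 2 by ring]
    ring
  · rw [← ENNReal.ofReal_add (by positivity) (by positivity)]
    exact ENNReal.ofReal_le_ofReal (by linarith)

theorem hasRatio_star {ι : Type*} [Finite ι] {A : ι → Finset V} {X : Finset V}
    (hX : ∀ x, x ∈ X ↔ ∃ i, x ∈ A i) (hne : ∀ i, (A i).Nonempty) {D : ℝ} (hD : 0 < D)
    (hdist : ∀ i j, i ≠ j → ∀ x ∈ A i, ∀ y ∈ A j, D / 16 ≤ dist x y ∧ dist x y ≤ D)
    {r : ι → ℝ} (hr : ∀ i, 0 < r i) (h : ∀ i, HasRatio (A i) D (r i)) {i₀ : ι} {J : Finset ι}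
    (hi₀ : i₀ ∉ J) {s r' : ℝ} (hs : ∀ j ∈ J, s ≤ r j) (hr' : 0 < r')
    (himp : Improves (r i₀) s #J r') : HasRatio X (2 * D) r' := by
  classical
  have := Fintype.ofFinite ι
  choose p hp using h
  obtain ⟨n, hn, G, B, hB, hG, hrate⟩ := himp
  have hdisj (i j) (hij : i ≠ j) : Disjoint (A i) (A j) := by
    refine Finset.disjoint_left.2 fun x hx hx' => ?_
    have hsep := (hdist i j hij x hx x hx').1
    rw [dist_self] at hsep
    linarith
  obtain ⟨side, hside⟩ := exists_side J G hi₀ (o := fun i => D / (48 * r i))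
    (by have := hr i₀; positivity) hD.le (B := D / 48 * B) (by positivity) fun w hw i hi => by
      have := hr i
      rw [mul_div_assoc', div_le_iff₀ (by positivity)]
      nlinarith [hG w hw, mul_le_mul_of_nonneg_left (hs i hi) hB]
  refine hasRatio_two_mul hD.le ⟨?_, ?_⟩ (p := star A p)
  · exact half_le_expect_star hX (ENNReal.ofReal_le_ofReal (by linarith)) (fun i => (hp i).online)
      fun i j hij x hx y hy => by
        rw [edist_dist]
        exact ENNReal.ofReal_le_ofReal (hdist i j hij x hx y hy).1
  · refine exists_offline_bound_star (i₀ := i₀)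
      (D := fun i => if i = i₀ then 0 else ENNReal.ofReal D)
      (fun i x hx => (hX x).2 ⟨i, hx⟩) hne hdisj
      (fun u hu i => ?_) (fun i => (hp i).offline) ENNReal.ofReal_ne_top hn side (hside.trans ?_)
    · split_ifs with hi
      · simp [hi]
      · rw [edist_dist]
        exact ENNReal.ofReal_le_ofReal (hdist i i₀ hi _ (hu i) _ (hu i₀)).2
    · rw [← ENNReal.ofReal_natCast, ← ENNReal.ofReal_mul (Nat.cast_nonneg _)]
      refine ENNReal.ofReal_le_ofReal ?_
      have := hr i₀
      calc _ = D / 48 * phaseRate n #J G.dens (r i₀) B := by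
            rw [phaseRate, Fintype.card_fin]
            field_simp
            ring
        _ ≤ D / 48 * (n / (2 * r')) := by gcongr
        _ = _ := by field_simp; norm_num

end Ratio

section Hierarchy

variable {V : Type*} [MetricSpace V]

/-- A hierarchically separated set of `n` levels: on level `n`, the parts of the next lower level
have mutual distances between `δ * 2 ^ n / 16` and `δ * 2 ^ n`. -/
def Hierarchical (δ : ℝ) : ℕ → Finset V → Prop
  | 0, S => ∃ v, S = {v}
  | n + 1, S => ∃ P : Finset (Finset V), P.Nonempty ∧ (∀ p ∈ P, Hierarchical δ n p) ∧
      (∀ p ∈ P, ∀ q ∈ P, p ≠ q → ∀ x ∈ p, ∀ y ∈ q,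
        δ * 2 ^ (n + 1) / 16 ≤ dist x y ∧ dist x y ≤ δ * 2 ^ (n + 1)) ∧
      ∀ x, x ∈ S ↔ ∃ p ∈ P, x ∈ p

theorem exists_hasRatio_of_hierarchical : ∃ C : ℝ, 0 < C ∧ ∀ {V : Type*} [MetricSpace V] (δ : ℝ),
    0 < δ → ∀ (n : ℕ) (S : Finset V), Hierarchical δ n S →
    ∃ S' ⊆ S, S'.Nonempty ∧ ∃ r : ℝ, 1 ≤ r ∧ HasRatio S' (δ * 2 ^ (n + 1)) r ∧
      #S ≤ Real.exp (C * r) := by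
  classical
  obtain ⟨C, hC, himp⟩ := exists_improves_sum_exp_le
  refine ⟨C, hC, fun {V} _ δ hδ n => ?_⟩
  induction n with
  | zero =>
    rintro S ⟨v, rfl⟩
    refine ⟨{v}, subset_rfl, by simp, 1, le_rfl, hasRatio_singleton v (by positivity), ?_⟩
    simpa using hC.le
  | succ n ih =>
    rintro S ⟨P, hP, hPn, hsep, hS⟩
    have := hP.to_subtype
    choose A hAP hne r hr hratio hcard using fun p : P => ih p (hPn p p.2)
    obtain ⟨i₀, J, s, r', hi₀, hs, hgain, hr', hsum⟩ := himp r hr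
    have hX (x : V) : x ∈ Finset.univ.biUnion A ↔ ∃ p, x ∈ A p := by simp
    refine ⟨Finset.univ.biUnion A, fun x hx => ?_, ?_, r', (hr i₀).trans hr', ?_, ?_⟩
    · obtain ⟨p, hp⟩ := (hX x).1 hx
      exact (hS x).2 ⟨p, p.2, hAP p hp⟩
    · exact Finset.biUnion_nonempty.2 ⟨i₀, Finset.mem_univ _, hne i₀⟩
    · rw [pow_succ, ← mul_assoc, mul_comm]
      exact hasRatio_star hX hne (by positivity)
        (fun p q hpq x hx y hy => hsep p p.2 q q.2 (Subtype.coe_ne_coe.2 hpq) x (hAP p hx) y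
          (hAP q hy))
        (fun p => zero_lt_one.trans_le (hr p)) hratio hi₀ hs
        (zero_lt_one.trans_le ((hr i₀).trans hr')) hgain
    · have hSP : S = P.biUnion id := by ext x; simp [hS]
      calc (#S : ℝ) ≤ ∑ p ∈ P, (#p : ℝ) := by
            rw [hSP]
            exact_mod_cast Finset.card_biUnion_le
        _ = ∑ p : P, (#(p : Finset V) : ℝ) := (Finset.sum_coe_sort P _).symm
        _ ≤ ∑ p, Real.exp (C * r p) := Finset.sum_le_sum fun p _ => hcard p
        _ ≤ _ := hsum

theorem Hierarchical.succ {δ : ℝ} {n : ℕ} {S : Finset V} (h : Hierarchical δ n S) :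
    Hierarchical δ (n + 1) S :=
  ⟨{S}, by simp, by simpa using h, by simp +contextual, by simp⟩

open Classical in
theorem Hierarchical.union {δ : ℝ} {n : ℕ} {S T : Finset V} (hS : Hierarchical δ n S)
    (hT : Hierarchical δ (n + 1) T)
    (hST : ∀ x ∈ S, ∀ y ∈ T,
      δ * 2 ^ (n + 1) / 16 ≤ dist x y ∧ dist x y ≤ δ * 2 ^ (n + 1)) :
    Hierarchical δ (n + 1) (S ∪ T) := by
  obtain ⟨P, -, hPn, hsep, hmem⟩ := hT
  refine ⟨insert S P, by simp, Finset.forall_mem_insert _ _ _ |>.2 ⟨hS, hPn⟩, ?_, by simp [hmem]⟩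
  intro p hp q hq hpq x hx y hy
  rw [Finset.mem_insert] at hp hq
  rcases hp with rfl | hp <;> rcases hq with rfl | hq
  · exact absurd rfl hpq
  · exact hST x hx y ((hmem y).2 ⟨q, hq, hy⟩)
  · rw [dist_comm]
    exact hST y hy x ((hmem x).2 ⟨p, hp, hx⟩)
  · exact hsep p hp q hq hpq x hx y hy

/-- One of the two annuli between the radii `2 * t`, `3 * t` and `4 * t` is thin. -/
theorem exists_thin_annulus {X : Finset V} {x : V} {t : ℝ} {N : ℕ} (ht : 0 ≤ t)
    (hN : #{y ∈ X | dist x y ≤ 4 * t} ≤ N) : ∃ s, 0 ≤ s ∧ s ≤ 3 * t ∧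
      #{y ∈ X | dist x y ≤ s + t} ^ 2 * #{y ∈ X | dist x y ≤ 2 * t} ≤
        #{y ∈ X | dist x y ≤ s} ^ 2 * N := by
  set a := #{y ∈ X | dist x y ≤ 2 * t} with ha
  set b := #{y ∈ X | dist x y ≤ 3 * t} with hb
  set d := #{y ∈ X | dist x y ≤ 4 * t} with hd
  rcases le_total (b ^ 2) (a * d) with h | h
  · refine ⟨2 * t, by positivity, by linarith, ?_⟩
    rw [show 2 * t + t = 3 * t by ring, ← ha, ← hb]
    calc b ^ 2 * a ≤ a * d * a := by gcongr
      _ = a ^ 2 * d := by ring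
      _ ≤ a ^ 2 * N := by gcongr
  · refine ⟨3 * t, by positivity, le_rfl, ?_⟩
    rw [show 3 * t + t = 4 * t by ring, ← hb, ← hd]
    calc d ^ 2 * a = a * d * d := by ring
      _ ≤ b ^ 2 * N := by gcongr

/-- `P` is the ball around a centre of the densest ball of radius `D / 8` that is cut off by a thin
annulus, and `R` is the ball that contains the annulus as well. -/
theorem exists_separated_part {X : Finset V} (hX : X.Nonempty) {D : ℝ} (hD : 0 < D) {N : ℕ}
    (hN : ∀ x ∈ X, #{y ∈ X | dist x y ≤ D / 4} ≤ N) :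
    ∃ P R : Finset V, P.Nonempty ∧ P ⊆ R ∧ R ⊆ X ∧ (∀ x ∈ P, ∀ y ∈ P, dist x y ≤ D / 2) ∧
      (∀ x ∈ P, ∀ y ∈ X, y ∉ R → D / 16 ≤ dist x y) ∧
      ∃ M, 0 < M ∧ (∀ x ∈ P, #{y ∈ P | dist x y ≤ D / 8} ≤ M) ∧ #R ^ 2 * M ≤ #P ^ 2 * N := by
  obtain ⟨x, hx, hmax⟩ := X.exists_max_image (fun y => #{z ∈ X | dist y z ≤ D / 8}) hX
  obtain ⟨s, hs, hs', hcut⟩ := exists_thin_annulus (X := X) (x := x) (t := D / 16) (N := N)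
    (by positivity) (by rw [show 4 * (D / 16) = D / 4 by ring]; exact hN x hx)
  have hself {u : ℝ} (hu : 0 ≤ u) : x ∈ ({y ∈ X | dist x y ≤ u} : Finset V) := by simp [hx, hu]
  refine ⟨{y ∈ X | dist x y ≤ s}, {y ∈ X | dist x y ≤ s + D / 16}, ⟨x, hself hs⟩,
    Finset.monotone_filter_right _ fun y _ hy => hy.trans (by linarith), Finset.filter_subset _ _,
    fun y hy z hz => ?_, fun y hy z hz hzR => ?_, #{y ∈ X | dist x y ≤ D / 8},
    Finset.card_pos.2 ⟨x, hself (by positivity)⟩, fun y hy => ?_, ?_⟩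
  · rw [Finset.mem_filter] at hy hz
    linarith [dist_triangle_left y z x]
  · have hxz : s + D / 16 < dist x z := by simpa [hz] using hzR
    linarith [dist_triangle x y z, (Finset.mem_filter.1 hy).2]
  · exact (Finset.card_le_card (Finset.filter_subset_filter _ (Finset.filter_subset _ _))).trans
      (hmax y (Finset.mem_filter.1 hy).1)
  · rwa [show 2 * (D / 16) = D / 8 by ring] at hcut

theorem le_mul_sqrt_of_sq_mul_le {a b y m n : ℝ} (hb : 0 ≤ b) (hy : 0 ≤ y) (hm : 0 < m)
    (hn : 0 ≤ n) (hab : a ^ 2 * m ≤ b ^ 2 * n) (hby : b ≤ y * √m) : a ≤ y * √n := by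
  refine le_of_sq_le_sq (le_of_mul_le_mul_right ?_ hm) (by positivity)
  calc a ^ 2 * m ≤ b ^ 2 * n := hab
    _ ≤ (y * √m) ^ 2 * n := by gcongr
    _ = (y * √n) ^ 2 * m := by
      rw [mul_pow, mul_pow, Real.sq_sqrt hm.le, Real.sq_sqrt hn]
      ring

theorem exists_hierarchical_of_forall_subset {δ c : ℝ} {n : ℕ} {X : Finset V} (hX : X.Nonempty)
    (hdiam : ∀ x ∈ X, ∀ y ∈ X, dist x y ≤ δ * 2 ^ (n + 1))
    (hpart : ∀ X' ⊆ X, X'.Nonempty → ∃ Y R : Finset V, Y ⊆ R ∧ R ⊆ X' ∧ R.Nonempty ∧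
      Hierarchical δ n Y ∧ (∀ x ∈ Y, ∀ y ∈ X', y ∉ R → δ * 2 ^ (n + 1) / 16 ≤ dist x y) ∧
      #R ≤ #Y * c) :
    ∃ Y ⊆ X, Hierarchical δ (n + 1) Y ∧ #X ≤ #Y * c := by
  classical
  induction X using Finset.strongInduction with
  | H X ih =>
    obtain ⟨Y, R, hYR, hRX, hR, hY, hsep, hcard⟩ := hpart X subset_rfl hX
    rcases (X \ R).eq_empty_or_nonempty with hXR | hXR
    · rw [Finset.sdiff_eq_empty_iff_subset] at hXR
      exact ⟨Y, hYR.trans hRX, hY.succ, hXR.antisymm hRX ▸ hcard⟩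
    · obtain ⟨Z, hZX, hZ, hXZ⟩ := ih (X \ R) (Finset.sdiff_ssubset hRX hR) hXR
        (fun x hx y hy => hdiam x (Finset.sdiff_subset hx) y (Finset.sdiff_subset hy))
        fun X' hX' => hpart X' (hX'.trans Finset.sdiff_subset)
      have hYZ : Disjoint Y Z := Finset.disjoint_left.2 fun x hxY hxZ =>
        (Finset.mem_sdiff.1 (hZX hxZ)).2 (hYR hxY)
      refine ⟨Y ∪ Z, Finset.union_subset (hYR.trans hRX) (hZX.trans Finset.sdiff_subset),
        hY.union hZ fun x hx y hy => ?_, ?_⟩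
      · obtain ⟨hyX, hyR⟩ := Finset.mem_sdiff.1 (hZX hy)
        exact ⟨hsep x hx y hyX hyR, hdiam x (hRX (hYR hx)) y hyX⟩
      · rw [Finset.card_union_of_disjoint hYZ, ← Finset.card_sdiff_add_card_eq_card hRX]
        push_cast
        linarith

theorem exists_hierarchical {δ : ℝ} (hδ : 0 < δ) (hmin : ∀ x y : V, x ≠ y → δ < dist x y) (n : ℕ)
    (X : Finset V) (hX : X.Nonempty) (hdiam : ∀ x ∈ X, ∀ y ∈ X, dist x y ≤ δ * 2 ^ n) (N : ℕ)
    (hN : ∀ x ∈ X, #{y ∈ X | dist x y ≤ δ * 2 ^ n / 4} ≤ N) :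
    ∃ Y ⊆ X, Hierarchical δ n Y ∧ #X ≤ #Y * √N := by
  induction n generalizing X N with
  | zero =>
    obtain ⟨v, hv⟩ := hX
    have hXv : X = {v} := by
      refine Finset.eq_singleton_iff_unique_mem.2 ⟨hv, fun y hy => ?_⟩
      by_contra hne
      have hdist := hdiam y hy v hv
      rw [pow_zero, mul_one] at hdist
      exact hdist.not_gt (hmin y v hne)
    have hN1 : 1 ≤ N :=
      (Finset.card_pos.2 ⟨v, by simpa [hv] using div_nonneg hδ.le zero_le_four⟩).trans_le (hN v hv)
    exact ⟨X, subset_rfl, ⟨v, hXv⟩, le_mul_of_one_le_right (Nat.cast_nonneg _)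
      (Real.one_le_sqrt.2 (by exact_mod_cast hN1))⟩
  | succ n ih =>
    refine exists_hierarchical_of_forall_subset hX hdiam fun X' hX' hne => ?_
    obtain ⟨P, R, hP, hPR, hRX, hPdiam, hPsep, M, hM, hPM, hcut⟩ :=
      exists_separated_part hne (by positivity) fun x hx =>
        (Finset.card_le_card (Finset.filter_subset_filter _ hX')).trans (hN x (hX' hx))
    obtain ⟨Y, hYP, hY, hPY⟩ := ih P hP (fun x hx y hy => (hPdiam x hx y hy).trans_eq (by ring)) M
      fun x hx => by
        rw [show δ * 2 ^ n / 4 = δ * 2 ^ (n + 1) / 8 by ring]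
        exact hPM x hx
    exact ⟨Y, R, hYP.trans hPR, hRX, hP.mono hPR, hY, fun x hx => hPsep x (hYP hx),
      le_mul_sqrt_of_sq_mul_le (Nat.cast_nonneg #P) (Nat.cast_nonneg _) (by exact_mod_cast hM)
        (Nat.cast_nonneg _) (by exact_mod_cast hcut) hPY⟩

theorem exists_hierarchical_of_finite (V : Type*) [MetricSpace V] [Fintype V] [Nonempty V] :
    ∃ δ : ℝ, 0 < δ ∧ ∃ (n : ℕ) (Y : Finset V), Hierarchical δ n Y ∧ Fintype.card V ≤ #Y ^ 2 := by
  obtain ⟨δ, hmin, hδ⟩ : ∃ δ : ℝ, (∀ z : V × V, z.1 ≠ z.2 → δ < dist z.1 z.2) ∧ 0 < δ := by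
    refine Filter.Eventually.exists (f := nhdsWithin 0 (Set.Ioi 0))
      ((Filter.eventually_all.2 fun z => ?_).and self_mem_nhdsWithin)
    by_cases hz : z.1 = z.2
    · simp [hz]
    · filter_upwards [Ioo_mem_nhdsGT (dist_pos.2 hz)] with δ hδ _ using hδ.2
  obtain ⟨n, hn⟩ : ∃ n : ℕ, ∀ z : V × V, dist z.1 z.2 ≤ δ * 2 ^ n :=
    (Filter.eventually_all.2 fun z : V × V => ((tendsto_pow_atTop_atTop_of_one_lt
      one_lt_two).const_mul_atTop hδ).eventually_ge_atTop (dist z.1 z.2)).exists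
  obtain ⟨Y, -, hY, hcard⟩ := exists_hierarchical hδ (fun x y => hmin (x, y)) n Finset.univ
    Finset.univ_nonempty (fun x _ y _ => hn (x, y)) (Fintype.card V)
    fun x _ => Finset.card_le_univ _
  refine ⟨δ, hδ, n, Y, hY, ?_⟩
  have hV : (0 : ℝ) < Fintype.card V := by exact_mod_cast Fintype.card_pos
  rw [Finset.card_univ] at hcard
  nth_rw 1 [← Real.mul_self_sqrt hV.le] at hcard
  exact_mod_cast Real.sqrt_le_left (Nat.cast_nonneg #Y) |>.1
    (le_of_mul_le_mul_right hcard (Real.sqrt_pos.2 hV))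

end Hierarchy

section Competitive

variable {V : Type*} [MetricSpace V]

open Classical in
/-- The task that agrees with `t` on `S` and makes all other states impossible. -/
noncomputable def confine (S : Finset V) (t : Task V) : Task V := fun v => if v ∈ S then t v else ∞

/-- The task sequence `σ` confined to `S`; the additional first task enforces a start in `S`. -/
noncomputable def confineSeq (S : Finset V) (σ : List (Task V)) : List (Task V) :=
  (0 :: σ).map (confine S)

theorem cost_cons (t : Task V) (σ : List (Task V)) (u : ℕ → V) :
    cost (t :: σ) u = edist (u 0) (u 1) + t (u 1) + cost σ fun i => u (i + 1) := by
  simp only [cost, List.length_cons]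
  rw [Fin.sum_univ_succ]
  rfl

theorem localCost_le_cost_map_confine (S : Finset V) (γ : ℝ≥0∞) (σ : List (Task V))
    (g : List (Task V) → V) :
    localCost S γ σ (fun τ => g (τ.map (confine S))) ≤
      cost (σ.map (confine S)) fun i => g ((σ.map (confine S)).take i) := by
  induction σ generalizing g with
  | nil => exact zero_le
  | cons t σ ih =>
    rw [List.map_cons, cost_cons, localCost]
    refine add_le_add ?_ (by simpa using ih fun τ => g (confine S t :: τ))
    simp only [List.map_nil, List.map_cons, List.take_zero, List.take_succ_cons]
    unfold stepCost
    split_ifs with _ hy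
    · simp [confine, hy]
    · simp [confine, hy]
    · exact zero_le

theorem optCost_cons_le (t : Task V) (σ : List (Task V)) (u v : V) :
    optCost u (t :: σ) ≤ edist u v + t v + optCost v σ := by
  simp only [optCost, ENNReal.add_iInf]
  refine le_iInf₂ fun w hw => iInf₂_le_of_le (fun n => n.casesOn u w) rfl ?_
  rw [cost_cons, ← hw]
  exact le_rfl

theorem optCost_map_confine_le (S : Finset V) (σ : List (Task V)) (u : V) :
    optCost u (σ.map (confine S)) ≤ localOptCost S σ u := by
  induction σ generalizing u with
  | nil =>
    rw [List.map_nil]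
    exact iInf₂_le_of_le (fun _ => u) rfl (by simp [cost])
  | cons t σ ih =>
    refine le_iInf₂ fun v hv => (optCost_cons_le _ _ u v).trans ?_
    gcongr
    · simp [confine, hv]
    · exact ih v

theorem optCost_confineSeq_le {S : Finset V} (σ : List (Task V)) (v₀ : V) {u : V} (hu : u ∈ S) :
    optCost v₀ (confineSeq S σ) ≤ edist v₀ u + localOptCost S σ u := by
  refine (optCost_cons_le _ _ v₀ u).trans ?_
  gcongr
  · simp [confine, hu]
  · exact optCost_map_confine_le S σ u

theorem measurable_cost_state [Countable V] {v₀ : V} {Ω : Type*} [MeasurableSpace Ω]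
    (A : RandomizedAlgorithm V v₀ Ω) (σ : List (Task V)) :
    Measurable fun ω => cost σ fun i => A.state (σ.take i) ω := by
  let _ : MeasurableSpace V := ⊤
  have hstate (τ : List (Task V)) : Measurable (A.state τ) :=
    measurable_to_countable' fun v => A.measurableSet_state τ v
  refine Finset.measurable_sum _ fun i _ => ?_
  exact (Measurable.of_discrete (f := fun x : V × V => edist x.1 x.2 + σ.get i x.2)).comp
    ((hstate _).prodMk (hstate _))

theorem lintegral_expect {α Ω : Type*} [MeasurableSpace Ω] (P : Measure Ω) (p : PMF α)
    {f : α → Ω → ℝ≥0∞} (hf : ∀ x, Measurable (f x)) :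
    ∫⁻ ω, expect p (fun x => f x ω) ∂P = expect p fun x => ∫⁻ ω, f x ω ∂P := by
  have hsupport (F : α → ℝ≥0∞) : expect p F = ∑' x : p.support, p x * F x :=
    (tsum_subtype_eq_of_support_subset fun x hx =>
      (p.mem_support_iff x).2 (left_ne_zero_of_mul hx)).symm
  have := p.support_countable.to_subtype
  simp only [hsupport]
  rw [lintegral_tsum fun x : p.support => ((hf x).const_mul (p x)).aemeasurable]
  exact tsum_congr fun x => lintegral_const_mul _ (hf x)

variable {S : Finset V} {p : PMF (FreeMonoid (Task V))} {a γ o : ℝ≥0∞} {v₀ : V} {Ω : Type*}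
  [MeasurableSpace Ω] {P : Measure Ω} [IsProbabilityMeasure P]

theorem IsAdversary.le_expect_expectedCost [Countable V] (h : IsAdversary S p a γ o)
    (A : RandomizedAlgorithm V v₀ Ω) :
    a ≤ expect p fun σ => A.expectedCost P (confineSeq S σ.toList) := by
  have hω (ω : Ω) : a ≤ expect p fun σ => cost (confineSeq S σ.toList)
      fun i => A.state ((confineSeq S σ.toList).take i) ω := by
    by_cases h0 : A.state [confine S 0] ω ∈ S
    · refine (h.online (fun τ => A.state (confineSeq S τ) ω) h0).trans (expect_mono _ fun σ => ?_)
      simp only [confineSeq, List.map_cons]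
      rw [cost_cons]
      refine le_add_left ?_
      simpa using localCost_le_cost_map_confine S γ σ.toList fun τ => A.state (confine S 0 :: τ) ω
    · have htop : confine S 0 (A.state [confine S 0] ω) = ∞ := if_neg h0
      simp [confineSeq, cost_cons, htop, expect_const]
  calc a = ∫⁻ _, a ∂P := by simp
    _ ≤ ∫⁻ ω, expect p (fun σ => cost (confineSeq S σ.toList)
          fun i => A.state ((confineSeq S σ.toList).take i) ω) ∂P := lintegral_mono hω
    _ = _ := lintegral_expect P p fun σ => measurable_cost_state A _

theorem le_of_nat_mul_le_add {a b c : ℝ≥0∞} (hc : c ≠ ∞)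
    (h : ∀ n : ℕ, n * a ≤ n * b + c) : a ≤ b := by
  by_contra! hab
  obtain ⟨n, hn⟩ := ENNReal.exists_nat_mul_gt (tsub_pos_of_lt hab).ne' hc
  rw [ENNReal.mul_sub fun _ _ => ENNReal.natCast_ne_top n, lt_tsub_iff_left] at hn
  exact (h n).not_gt hn

theorem IsAdversary.le_mul_of_isCompetitive [Countable V] (h : IsAdversary S p a γ o)
    (hS : S.Nonempty) {A : RandomizedAlgorithm V v₀ Ω} {r : ℝ≥0} (hA : A.IsCompetitive P r) :
    a ≤ r * o := by
  obtain ⟨u, hu⟩ := hS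
  obtain ⟨c, hc⟩ := hA
  obtain ⟨c', hc', hoff⟩ := h.offline
  refine le_of_nat_mul_le_add (c := r * (edist v₀ u + c') + c) (by finiteness) fun T => ?_
  calc T * a ≤ expect (p ^ T) fun σ => A.expectedCost P (confineSeq S σ.toList) :=
        (h.pow T).le_expect_expectedCost A
    _ ≤ expect (p ^ T) fun σ => r * (edist v₀ u + localOptCost S σ.toList u) + c :=
        expect_mono _ fun σ => (hc _).trans (by gcongr; exact optCost_confineSeq_le _ v₀ hu)
    _ = r * (edist v₀ u + expect (p ^ T) fun σ => localOptCost S σ.toList u) + c := by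
        simp only [expect_add, expect_const_mul, expect_const]
    _ ≤ r * (edist v₀ u + (T * o + c')) + c := by gcongr; exact hoff T u hu
    _ = T * (r * o) + (r * (edist v₀ u + c') + c) := by ring

theorem HasRatio.le_of_isCompetitive [Countable V] {D r' : ℝ} (h : HasRatio S D r')
    (hS : S.Nonempty) (hD : 0 < D) (hr' : 0 < r') {A : RandomizedAlgorithm V v₀ Ω} {r : ℝ≥0}
    (hA : A.IsCompetitive P r) : r' ≤ r := by
  obtain ⟨p, hp⟩ := h
  have hle := hp.le_mul_of_isCompetitive hS hA
  rw [← ENNReal.ofReal_coe_nnreal, ← ENNReal.ofReal_mul r.coe_nonneg,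
    ENNReal.ofReal_le_ofReal_iff (by positivity)] at hle
  have hD48 : 0 < D / (48 * r') := by positivity
  refine le_of_mul_le_mul_right (le_trans (le_of_eq ?_) hle) hD48
  field_simp

end Competitive

theorem exists_mul_log_div_le : ∃ c : ℝ, 0 < c ∧ ∀ n : ℕ, 3 ≤ n →
    c * (Real.log n / Real.log (Real.log n) ^ 2) ≤ Real.log n := by
  have hlog3 : 1 < Real.log 3 :=
    (Real.lt_log_iff_exp_lt zero_lt_three).2 Real.exp_one_lt_three
  have hloglog3 : 0 < Real.log (Real.log 3) := Real.log_pos hlog3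
  refine ⟨Real.log (Real.log 3) ^ 2, by positivity, fun n hn => ?_⟩
  have hlog : Real.log 3 ≤ Real.log n := Real.log_le_log zero_lt_three (by exact_mod_cast hn)
  have hloglog : Real.log (Real.log 3) ≤ Real.log (Real.log n) :=
    Real.log_le_log (zero_lt_one.trans hlog3) hlog
  rw [mul_div_left_comm]
  refine mul_le_of_le_one_right (by linarith) (div_le_one_of_le₀ (by gcongr) (by positivity))

end MTS

theorem mainTheorem1_general :
    ∃ C : ℝ, 0 < C ∧
      ∀ (V : Type*) [MetricSpace V] [Fintype V] (v₀ : V) (Ω : Type*) [MeasurableSpace Ω]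
        (P : Measure Ω) [IsProbabilityMeasure P] (A : MTS.RandomizedAlgorithm V v₀ Ω) (r : ℝ≥0),
        A.IsCompetitive P r → C * Real.log (Fintype.card V) ≤ (r : ℝ) := by
  obtain ⟨K, hK, hratio⟩ := MTS.exists_hasRatio_of_hierarchical
  refine ⟨(2 * K)⁻¹, by positivity, fun V _ _ v₀ Ω _ P _ A r hA => ?_⟩
  have : Nonempty V := ⟨v₀⟩
  obtain ⟨δ, hδ, n, Y, hY, hVY⟩ := MTS.exists_hierarchical_of_finite V
  obtain ⟨S, -, hS, r', hr', hSr', hYr'⟩ := hratio δ hδ n Y hY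
  have hr'r : r' ≤ r :=
    hSr'.le_of_isCompetitive hS (by positivity) (zero_lt_one.trans_le hr') hA
  have hV : (0 : ℝ) < Fintype.card V := by exact_mod_cast Fintype.card_pos
  have hlog : Real.log (Fintype.card V) ≤ 2 * K * r' := by
    rw [Real.log_le_iff_le_exp hV]
    calc (Fintype.card V : ℝ) ≤ (Y.card : ℝ) ^ 2 := by exact_mod_cast hVY
      _ ≤ Real.exp (K * r') ^ 2 := by gcongr
      _ = Real.exp (2 * K * r') := by rw [← Real.exp_nat_mul, Nat.cast_two, mul_assoc]
  exact ((inv_mul_le_iff₀ (by positivity)).2 hlog).trans hr'r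

theorem mainTheorem1 :
    ∃ C : ℝ, 0 < C ∧
      ∀ (V : Type*) [MetricSpace V] [Fintype V], 3 ≤ Fintype.card V →
      ∀ (v₀ : V) (Ω : Type*) [MeasurableSpace Ω] (P : Measure Ω) [IsProbabilityMeasure P]
        (A : MTS.RandomizedAlgorithm V v₀ Ω) (r : ℝ≥0), A.IsCompetitive P r →
        C * (Real.log (Fintype.card V) / Real.log (Real.log (Fintype.card V)) ^ 2) ≤ (r : ℝ) := by
  obtain ⟨⟨C, hC, hr⟩, c, hc, hlog⟩ := And.intro mainTheorem1_general MTS.exists_mul_log_div_le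
  exact ⟨C * c, mul_pos hC hc, fun V _ _ hV v₀ Ω _ P _ A r hA =>
    (mul_assoc C c _).trans_le ((mul_le_mul_of_nonneg_left (hlog _ hV) hC.le).trans
      (hr V v₀ Ω P A r hA))⟩
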